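/- Let $n\in\{2,3\}$, let $\Omega\subset\mathbb R^n$ be a bounded Lipschitz domain, let $M\ge 2$, and let $E_1,\dots,E_M\subset\partial\Omega$ (the extended electrodes) be nonempty, connected, relatively open and mutually disjoint. Let $L^\infty(E)$ be the closed subspace of $L^\infty(\partial\Omega)$ of functions vanishing a.e. outside $E_1\cup\dots\cup E_M$, and $\mathbb C^M_\diamond=\{J\in\mathbb C^M:\sum_m J_m=0\}$. Identify $V\in\mathbb C^M$ with $\sum_m V_m\chi_{E_m}$ on $\partial\Omega$, write $a\cdot b=\sum_m a_mb_m$, and let $\mathcal H^1=(H^1(\Omega)\oplus\mathbb C^M)/\{(c,c\mathbf 1):c\in\mathbb C\}$ with the quotient norm $\inf_{c\in\mathbb C}(\|v-c\|_{H^1(\Omega)}^2+\|V-c\mathbf 1\|_2^2)^{1/2}$. For $\sigma\in L^\infty(\Omega)$, $\zeta\in L^\infty(E)$ (complex valued) set $$B_{\sigma,\zeta}\big((w,W),(v,V)\big)=\int_\Omega\sigma\nabla w\cdot\nabla\overline v\,dx+\int_{\partial\Omega}\zeta\,(W-w)(\overline V-\overline v)\,dS ,$$ with boundary values of $H^1(\Omega)$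 functions in the sense of traces. Call $B_{\sigma,\zeta}$ coercive if for some $c>0$ one has $\mathrm{Re}\,B_{\sigma,\zeta}((v,V),(v,V))\ge c\,\|(v,V)\|_{\mathcal H^1}^2$ for all $(v,V)$. Let $$\mathcal S=\{\sigma\in L^\infty(\Omega):\operatorname{ess\,inf}\mathrm{Re}\,\sigma>0\},\qquad \mathcal Z'=\{\zeta\in L^\infty(E): B_{\sigma,\zeta}\text{ is coercive for every }\sigma\in\mathcal S\},$$ $$\mathcal D=\{(\sigma,\zeta)\in\mathcal S\times L^\infty(E): B_{\sigma,\zeta}\text{ is coercive}\}.$$ **Theorem.** The set $\mathcal D$ is open in $L^\infty(\Omega)\times L^\infty(E)$ and contains $\mathcal S\times\mathcal Z'$. For every $(\sigma,\zeta)\in\mathcal D$ and $I\in\mathbb C^M_\diamond$ there is exactly one $(u,U)\in\mathcal H^1$ with $$B_{\sigma,\zeta}\big((u,U),(v,V)\big)=I\cdot\overline V\qquad\text{for all }(v,V)\in\mathcal H^1; \tag{1}$$ let $U(\sigma,\zeta,I)\in\mathbb C^M_\diamond$ be its second component, with the ground level chosen so that it has zero mean. Then $(\sigma,\zeta,I)\mapsto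 U(\sigma,\zeta,I)$ is Fréchet differentiable at every point of $\mathcal D\times\mathbb C^M_\diamond$, in particular at every point of $\mathcal S\times\mathcal Z'\times\mathbb C^M_\diamond$, and its derivative, the bounded linear map $(\omega,\eta,J)\mapsto U'(\sigma,\zeta,I;\omega,\eta,J)$ from $L^\infty(\Omega)\times L^\infty(E)\times\mathbb C^M_\diamond$ to $\mathbb C^M_\diamond$, has the following properties. 1. There are $C,\delta>0$, depending on $(\sigma,\zeta,I)$ (and on $\Omega$ and the $E_m$), such that whenever $\|\omega\|_{L^\infty(\Omega)},\|\eta\|_{L^\infty(E)}\le\delta$ and $J\in\mathbb C^M_\diamond$, one has $(\sigma+\omega,\zeta+\eta)\in\mathcal D$ and $$\big\|U(\sigma+\omega,\zeta+\eta,I+J)-U(\sigma,\zeta,I)-U'(\sigma,\zeta,I;\omega,\eta,J)\big\|_2\le C\max\{\|\omega\|_{L^\infty(\Omega)}^2,\|\eta\|_{L^\infty(E)}^2,\|J\|_2^2\}.$$ 2. For all $\omega\in L^\infty(\Omega)$, $\eta\in L^\infty(E)$, $J\in\mathbb C^M_\diamond$, with $(u,U)$ the solution of (1), the problem $$B_{\sigma,\zeta}\big((u',U'),(v,V)\big)=J\cdot\overline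 V-\int_\Omega\omega\nabla u\cdot\nabla\overline v\,dx-\int_{\partial\Omega}\eta\,(U-u)(\overline V-\overline v)\,dS\quad\text{for all }(v,V)\in\mathcal H^1$$ has exactly one solution $(u',U')\in\mathcal H^1$, and $U'(\sigma,\zeta,I;\omega,\eta,J)$ is its zero-mean second component. 3. If $\tilde I\in\mathbb C^M_\diamond$ and $(\tilde u,\tilde U)$ is the solution of (1) at the same $(\sigma,\zeta)$ with $I$ replaced by $\tilde I$, then $$U'(\sigma,\zeta,I;\omega,\eta,J)\cdot\tilde I=J\cdot\tilde U-\int_\Omega\omega\nabla u\cdot\nabla\tilde u\,dx-\int_{\partial\Omega}\eta\,(U-u)(\tilde U-\tilde u)\,dS .$$ -/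

import Mathlib

open MeasureTheory Topology
open scoped ENNReal

noncomputable section

namespace EIT

/-- The ambient Euclidean space `ℝⁿ`. -/
abbrev Space (n : ℕ) : Type := EuclideanSpace ℝ (Fin n)

/-- `Ω` is a bounded Lipschitz domain: nonempty, bounded, open, connected, and near each boundary
point, in suitable Cartesian coordinates with last axis `e`, it is the set of points lying above
the graph of a Lipschitz function defined on the hyperplane orthogonal to `e`. -/
structure IsBoundedLipschitzDomain {n : ℕ} (Ω : Set (Space n)) : Prop where
  isOpen : IsOpen Ω
  isConnected : IsConnected Ω
  isBounded : Bornology.IsBounded Ω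
  lipschitz : ∀ x₀ ∈ frontier Ω, ∃ r : ℝ, 0 < r ∧ ∃ e : Space n, ‖e‖ = 1 ∧
    ∃ (K : NNReal) (γ : ((Submodule.span ℝ {e})ᗮ : Submodule ℝ (Space n)) → ℝ),
      LipschitzWith K γ ∧ ∀ x ∈ Metric.ball x₀ r,
        (x ∈ Ω ↔ γ ((Submodule.span ℝ {e})ᗮ.orthogonalProjectionOnto x) < inner ℝ e x)

/-- Lebesgue measure on `Ω`. -/
abbrev vol {n : ℕ} (Ω : Set (Space n)) : Measure (Space n) := volume.restrict Ω

/-- The surface measure `dS` on `∂Ω`: the `(n-1)`-dimensional Hausdorff measure, normalized so that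
it agrees with Lebesgue measure on `(n-1)`-dimensional Euclidean spaces. -/
abbrev surf {n : ℕ} (Ω : Set (Space n)) : Measure (Space n) :=
  (Measure.euclideanHausdorffMeasure (n - 1)).restrict (frontier Ω)

/-- `L²(Ω) ⊕ L²(Ω)ⁿ` with its Hilbert space norm. -/
abbrev L2Pair {n : ℕ} (Ω : Set (Space n)) : Type :=
  WithLp 2 (Lp ℂ 2 (vol Ω) × Lp (EuclideanSpace ℂ (Fin n)) 2 (vol Ω))

/-- `g` is the weak gradient of `f` in `Ω`: `∫_Ω f ∂ᵢφ = - ∫_Ω gᵢ φ` for all `φ ∈ C_c^∞(Ω)`. -/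
def IsWeakGradient {n : ℕ} (Ω : Set (Space n)) (f : Space n → ℂ)
    (g : Space n → EuclideanSpace ℂ (Fin n)) : Prop :=
  ∀ φ : Space n → ℝ, ContDiff ℝ ((⊤ : ℕ∞) : WithTop ℕ∞) φ → HasCompactSupport φ →
    tsupport φ ⊆ Ω → ∀ i : Fin n,
      ∫ x in Ω, ((fderiv ℝ φ x (EuclideanSpace.single i 1) : ℝ) : ℂ) * f x
        = - ∫ x in Ω, ((φ x : ℝ) : ℂ) * g x i

lemma integrable_test_mul {n : ℕ} (Ω : Set (Space n)) {ψ : Space n → ℝ} (hc : Continuous ψ)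
    (hs : HasCompactSupport ψ) {f : Space n → ℂ} (hf : MemLp f 2 (vol Ω)) :
    Integrable (fun x => ((ψ x : ℝ) : ℂ) * f x) (vol Ω) := by
  have h1 : MemLp (fun x => ((ψ x : ℝ) : ℂ)) 2 (vol Ω) :=
    (Complex.continuous_ofReal.comp hc).memLp_of_hasCompactSupport
      (hs.comp_left Complex.ofReal_zero)
  exact h1.integrable_mul hf

lemma memLp_coord {n : ℕ} {μ : Measure (Space n)} (g : Lp (EuclideanSpace ℂ (Fin n)) 2 μ)
    (i : Fin n) : MemLp (fun x => g x i) 2 μ :=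
  (EuclideanSpace.proj i : EuclideanSpace ℂ (Fin n) →L[ℂ] ℂ).comp_memLp' (Lp.memLp g)

/-- The complex Sobolev space `H¹(Ω)`, each `v` being stored together with its weak gradient:
`‖v‖² = ‖v‖²_{L²(Ω)} + ‖∇v‖²_{L²(Ω)}`. -/
def H1 {n : ℕ} (Ω : Set (Space n)) : Submodule ℂ (L2Pair Ω) where
  carrier := {p | IsWeakGradient Ω p.fst p.snd}
  zero_mem' := by
    intro φ hφ hs hΩ i
    have h1 : (fun x => ((fderiv ℝ φ x (EuclideanSpace.single i 1) : ℝ) : ℂ) *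
        ((0 : L2Pair Ω).fst : Space n → ℂ) x) =ᵐ[vol Ω] 0 := by
      filter_upwards [Lp.coeFn_zero ℂ 2 (vol Ω)] with x hx
      simp only [WithLp.zero_fst, hx]; simp
    have h2 : (fun x => ((φ x : ℝ) : ℂ) *
        ((0 : L2Pair Ω).snd : Space n → EuclideanSpace ℂ (Fin n)) x i) =ᵐ[vol Ω] 0 := by
      filter_upwards [Lp.coeFn_zero (EuclideanSpace ℂ (Fin n)) 2 (vol Ω)] with x hx
      simp only [WithLp.zero_snd, hx]; simp
    rw [integral_congr_ae h1, integral_congr_ae h2]; simp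
  add_mem' := by
    intro p q hp hq φ hφ hs hΩ i
    have hd : Continuous fun x => fderiv ℝ φ x (EuclideanSpace.single i 1) :=
      (hφ.continuous_fderiv (by simp)).clm_apply continuous_const
    have hds : HasCompactSupport fun x => fderiv ℝ φ x (EuclideanSpace.single i 1) :=
      hs.fderiv_apply ℝ _
    have h1 : (fun x => ((fderiv ℝ φ x (EuclideanSpace.single i 1) : ℝ) : ℂ) *
        ((p + q).fst : Space n → ℂ) x) =ᵐ[vol Ω] fun x =>
        ((fderiv ℝ φ x (EuclideanSpace.single i 1) : ℝ) : ℂ) * p.fst x +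
        ((fderiv ℝ φ x (EuclideanSpace.single i 1) : ℝ) : ℂ) * q.fst x := by
      filter_upwards [Lp.coeFn_add p.fst q.fst] with x hx
      simp only [WithLp.add_fst, hx, Pi.add_apply]; ring
    have h2 : (fun x => ((φ x : ℝ) : ℂ) *
        ((p + q).snd : Space n → EuclideanSpace ℂ (Fin n)) x i) =ᵐ[vol Ω] fun x =>
        ((φ x : ℝ) : ℂ) * p.snd x i + ((φ x : ℝ) : ℂ) * q.snd x i := by
      filter_upwards [Lp.coeFn_add p.snd q.snd] with x hx
      simp only [WithLp.add_snd, hx, Pi.add_apply, PiLp.add_apply]; ring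
    rw [integral_congr_ae h1, integral_congr_ae h2,
      integral_add (integrable_test_mul Ω hd hds (Lp.memLp _))
        (integrable_test_mul Ω hd hds (Lp.memLp _)),
      integral_add (integrable_test_mul Ω hφ.continuous hs (memLp_coord _ i))
        (integrable_test_mul Ω hφ.continuous hs (memLp_coord _ i)),
      hp φ hφ hs hΩ i, hq φ hφ hs hΩ i]
    ring
  smul_mem' := by
    intro c p hp φ hφ hs hΩ i
    have h1 : (fun x => ((fderiv ℝ φ x (EuclideanSpace.single i 1) : ℝ) : ℂ) *
        ((c • p).fst : Space n → ℂ) x) =ᵐ[vol Ω] fun x =>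
        c * (((fderiv ℝ φ x (EuclideanSpace.single i 1) : ℝ) : ℂ) * p.fst x) := by
      filter_upwards [Lp.coeFn_smul c p.fst] with x hx
      simp only [WithLp.smul_fst, hx, Pi.smul_apply, smul_eq_mul]; ring
    have h2 : (fun x => ((φ x : ℝ) : ℂ) *
        ((c • p).snd : Space n → EuclideanSpace ℂ (Fin n)) x i) =ᵐ[vol Ω] fun x =>
        c * (((φ x : ℝ) : ℂ) * p.snd x i) := by
      filter_upwards [Lp.coeFn_smul c p.snd] with x hx
      simp only [WithLp.smul_snd, hx, Pi.smul_apply, PiLp.smul_apply, smul_eq_mul]; ring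
    rw [integral_congr_ae h1, integral_congr_ae h2, integral_const_mul, integral_const_mul,
      hp φ hφ hs hΩ i]
    ring

/-- The function underlying an element of `H¹(Ω)`. -/
def valH1 {n : ℕ} {Ω : Set (Space n)} (v : H1 Ω) : Lp ℂ 2 (vol Ω) := v.1.fst

/-- The weak gradient of an element of `H¹(Ω)`. -/
def gradH1 {n : ℕ} {Ω : Set (Space n)} (v : H1 Ω) : Lp (EuclideanSpace ℂ (Fin n)) 2 (vol Ω) :=
  v.1.snd

/-- `g ∈ L²(∂Ω)` is the trace of `v ∈ H¹(Ω)`: the pair `(v, g)` lies in the closure, in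
`H¹(Ω) × L²(∂Ω)`, of the set of pairs `(φ|_Ω, φ|_∂Ω)` with `φ` smooth on `ℝⁿ`. -/
def IsTrace {n : ℕ} (Ω : Set (Space n)) (v : H1 Ω) (g : Lp ℂ 2 (surf Ω)) : Prop :=
  (v, g) ∈ closure {q : H1 Ω × Lp ℂ 2 (surf Ω) | ∃ φ : Space n → ℂ,
    ContDiff ℝ ((⊤ : ℕ∞) : WithTop ℕ∞) φ ∧ valH1 q.1 =ᵐ[vol Ω] φ ∧ q.2 =ᵐ[surf Ω] φ}

open Classical in
/-- The trace of `v ∈ H¹(Ω)` on `∂Ω` (on a bounded Lipschitz domain it exists and is unique). -/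
def trace {n : ℕ} (Ω : Set (Space n)) (v : H1 Ω) : Lp ℂ 2 (surf Ω) :=
  if h : ∃ g, IsTrace Ω v g then h.choose else 0

/-- The extended electrodes: nonempty, connected, relatively open, mutually disjoint subsets
of `∂Ω`. -/
structure AreExtendedElectrodes {n M : ℕ} (Ω : Set (Space n)) (E : Fin M → Set (Space n)) :
    Prop where
  subset : ∀ m, E m ⊆ frontier Ω
  relOpen : ∀ m, ∃ O : Set (Space n), IsOpen O ∧ E m = O ∩ frontier Ω
  connected : ∀ m, IsConnected (E m)
  disjoint : ∀ m l, m ≠ l → Disjoint (E m) (E l)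

/-- `L^∞(Ω)`. -/
abbrev LinfDom {n : ℕ} (Ω : Set (Space n)) : Type := Lp ℂ ⊤ (vol Ω)

/-- `L^∞(E)` for `E = ⋃ E_m`, as the subspace of `L^∞(∂Ω)` of functions vanishing off `E`. -/
def LinfE {n M : ℕ} (Ω : Set (Space n)) (E : Fin M → Set (Space n)) :
    Submodule ℂ (Lp ℂ ⊤ (surf Ω)) where
  carrier := {η | ∀ᵐ x ∂(surf Ω), x ∉ ⋃ m, E m → η x = 0}
  zero_mem' := by
    filter_upwards [Lp.coeFn_zero ℂ ⊤ (surf Ω)] with x hx _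
    exact hx
  add_mem' := by
    intro a b ha hb
    filter_upwards [ha, hb, Lp.coeFn_add a b] with x h1 h2 h3 hx
    rw [h3, Pi.add_apply, h1 hx, h2 hx, add_zero]
  smul_mem' := by
    intro c a ha
    filter_upwards [ha, Lp.coeFn_smul c a] with x h1 h3 hx
    rw [h3, Pi.smul_apply, h1 hx, smul_zero]

/-- `ℂ^M_⋄`: the vectors in `ℂ^M` with zero sum, with the Euclidean norm. -/
def Diamond (M : ℕ) : Submodule ℂ (EuclideanSpace ℂ (Fin M)) where
  carrier := {J | ∑ m, J m = 0}
  zero_mem' := by simp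
  add_mem' := by
    intro a b ha hb
    simp only [Set.mem_ofPred_eq] at ha hb ⊢
    simp [Finset.sum_add_distrib, ha, hb]
  smul_mem' := by
    intro c a ha
    simp only [Set.mem_ofPred_eq] at ha ⊢
    simp [← Finset.mul_sum, ha]

/-- `H¹(Ω) ⊕ ℂ^M` with norm `(‖v‖² + ‖V‖²)^{1/2}`. -/
abbrev PreH {n : ℕ} (Ω : Set (Space n)) (M : ℕ) : Type :=
  WithLp 2 (H1 Ω × EuclideanSpace ℂ (Fin M))

/-- The pairs `(c, c𝟏)`, `c ∈ ℂ`. -/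
def Consts {n : ℕ} (Ω : Set (Space n)) (M : ℕ) : Submodule ℂ (PreH Ω M) where
  carrier := {x | ∃ c : ℂ, (∀ᵐ y ∂(vol Ω), valH1 x.fst y = c) ∧ ∀ m, x.snd m = c}
  zero_mem' := by
    refine ⟨0, ?_, fun m => by simp⟩
    filter_upwards [Lp.coeFn_zero ℂ 2 (vol Ω)] with x hx
    simpa [valH1] using hx
  add_mem' := by
    rintro a b ⟨c, hc, hc'⟩ ⟨d, hd, hd'⟩
    refine ⟨c + d, ?_, fun m => by simp [hc', hd']⟩
    filter_upwards [hc, hd, Lp.coeFn_add (valH1 a.fst) (valH1 b.fst)] with x h1 h2 h3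
    have : valH1 (a + b).fst = valH1 a.fst + valH1 b.fst := rfl
    rw [this, h3, Pi.add_apply, h1, h2]
  smul_mem' := by
    rintro k a ⟨c, hc, hc'⟩
    refine ⟨k * c, ?_, fun m => by simp [hc']⟩
    filter_upwards [hc, Lp.coeFn_smul k (valH1 a.fst)] with x h1 h3
    have : valH1 (k • a).fst = k • valH1 a.fst := rfl
    rw [this, h3, Pi.smul_apply, h1, smul_eq_mul]

/-- The space `𝓗¹ = (H¹(Ω) ⊕ ℂ^M) / ℂ` with its quotient norm
`inf_c (‖v - c‖² + ‖V - c𝟏‖²)^{1/2}`. -/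
abbrev QuotH {n : ℕ} (Ω : Set (Space n)) (M : ℕ) : Type := PreH Ω M ⧸ Consts Ω M

/-- The class in `𝓗¹` of a pair `(v, V)`. -/
abbrev QuotH.mk {n M : ℕ} {Ω : Set (Space n)} (x : PreH Ω M) : QuotH Ω M :=
  Submodule.Quotient.mk x

/-- A vector `V ∈ ℂ^M` as the piecewise constant function `∑ V_m χ_m`. -/
def electrodeFn {n M : ℕ} (E : Fin M → Set (Space n)) (V : EuclideanSpace ℂ (Fin M))
    (x : Space n) : ℂ :=
  ∑ m, (E m).indicator (fun _ => V m) x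

/-- The function `V - v` on `∂Ω`, for `(v, V) ∈ H¹(Ω) ⊕ ℂ^M`. -/
def jump {n M : ℕ} {Ω : Set (Space n)} (E : Fin M → Set (Space n)) (x : PreH Ω M)
    (y : Space n) : ℂ :=
  electrodeFn E x.snd y - trace Ω x.fst y

/-- The form `B_{σ,ζ}((w,W),(v,V)) = ∫_Ω σ ∇w·∇v̄ dx + ∫_∂Ω ζ (W-w)(V̄-v̄) dS`. -/
def sesq {n M : ℕ} {Ω : Set (Space n)} (E : Fin M → Set (Space n)) (σ : LinfDom Ω)
    (ζ : LinfE Ω E) (x y : PreH Ω M) : ℂ :=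
  (∫ p, σ p * (∑ i, gradH1 x.fst p i * starRingEnd ℂ (gradH1 y.fst p i)) ∂(vol Ω))
    + ∫ p, ζ.1 p * (jump E x p * starRingEnd ℂ (jump E y p)) ∂(surf Ω)

/-- The bilinear form `∫_Ω σ ∇w·∇v dx + ∫_∂Ω ζ (W-w)(V-v) dS`. -/
def bilin {n M : ℕ} {Ω : Set (Space n)} (E : Fin M → Set (Space n)) (σ : LinfDom Ω)
    (ζ : LinfE Ω E) (x y : PreH Ω M) : ℂ :=
  (∫ p, σ p * (∑ i, gradH1 x.fst p i * gradH1 y.fst p i) ∂(vol Ω))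
    + ∫ p, ζ.1 p * (jump E x p * jump E y p) ∂(surf Ω)

/-- The admissible interior admittivities: `ess inf Re σ > 0`. -/
def admS {n : ℕ} (Ω : Set (Space n)) : Set (LinfDom Ω) :=
  {σ | ∃ c : ℝ, 0 < c ∧ ∀ᵐ x ∂(vol Ω), c ≤ (σ x).re}

/-- Coercivity of `B_{σ,ζ}` on `𝓗¹`. -/
def IsCoerciveAt {n M : ℕ} {Ω : Set (Space n)} (E : Fin M → Set (Space n)) (σ : LinfDom Ω)
    (ζ : LinfE Ω E) : Prop :=
  ∃ c : ℝ, 0 < c ∧ ∀ x : PreH Ω M, c * ‖QuotH.mk x‖ ^ 2 ≤ (sesq E σ ζ x x).re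

/-- The set `𝓩'` of those `ζ ∈ L^∞(E)` for which `B_{σ,ζ}` is coercive for every admissible `σ`. -/
def admZ' {n M : ℕ} (Ω : Set (Space n)) (E : Fin M → Set (Space n)) : Set (LinfE Ω E) :=
  {ζ | ∀ σ ∈ admS Ω, IsCoerciveAt E σ ζ}

/-- The pairs `(σ, ζ)` with `σ` admissible and `B_{σ,ζ}` coercive. -/
def coercivePairs {n M : ℕ} (Ω : Set (Space n)) (E : Fin M → Set (Space n)) :
    Set (LinfDom Ω × LinfE Ω E) :=
  {q | q.1 ∈ admS Ω ∧ IsCoerciveAt E q.1 q.2}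

/-- `p ∈ 𝓗¹` satisfies `B_{σ,ζ}(p, (v,V)) = F(v,V)` for all `(v,V)`. -/
def SolvesVar {n M : ℕ} {Ω : Set (Space n)} (E : Fin M → Set (Space n)) (σ : LinfDom Ω)
    (ζ : LinfE Ω E) (F : PreH Ω M → ℂ) (p : QuotH Ω M) : Prop :=
  ∀ x : PreH Ω M, QuotH.mk x = p → ∀ y : PreH Ω M, sesq E σ ζ x y = F y

/-- `p ∈ 𝓗¹` solves the forward problem `B_{σ,ζ}(p, (v,V)) = I · V̄` for all `(v,V)`. -/
def SolvesForward {n M : ℕ} {Ω : Set (Space n)} (E : Fin M → Set (Space n)) (σ : LinfDom Ω)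
    (ζ : LinfE Ω E) (I : Diamond M) (p : QuotH Ω M) : Prop :=
  SolvesVar E σ ζ (fun y => ∑ m, I.1 m * starRingEnd ℂ (y.snd m)) p

/-- `p ∈ 𝓗¹` solves the auxiliary problem
`B_{σ,ζ}(p, (v,V)) = J · V̄ - ∫_Ω ω ∇u·∇v̄ dx - ∫_∂Ω η (U-u)(V̄-v̄) dS` for all `(v,V)`,
where `(u,U)` is represented by `x`. -/
def SolvesAux {n M : ℕ} {Ω : Set (Space n)} (E : Fin M → Set (Space n)) (σ : LinfDom Ω)
    (ζ : LinfE Ω E) (x : PreH Ω M) (ω : LinfDom Ω) (η : LinfE Ω E) (J : Diamond M)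
    (p : QuotH Ω M) : Prop :=
  SolvesVar E σ ζ
    (fun y => (∑ m, J.1 m * starRingEnd ℂ (y.snd m)) - sesq E ω η x y) p

/-- `V ↦ V - (mean of V) 𝟏`. -/
def removeMean (M : ℕ) : EuclideanSpace ℂ (Fin M) →ₗ[ℂ] Diamond M where
  toFun V := ⟨WithLp.toLp 2 fun m => V m - (∑ l, V l) / M, by
    rcases Nat.eq_zero_or_pos M with rfl | hM
    · simp [Diamond]
    · have : (M : ℂ) ≠ 0 := by exact_mod_cast hM.ne'
      simp only [Diamond, Submodule.mem_mk, AddSubmonoid.mem_mk, AddSubsemigroup.mem_mk,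
        Set.mem_ofPred_eq, Finset.sum_sub_distrib, Finset.sum_const, Finset.card_univ,
        Fintype.card_fin, nsmul_eq_mul]
      field_simp
      ring⟩
  map_add' V W := by
    ext m
    simp [Finset.sum_add_distrib]
    ring
  map_smul' c V := by
    ext m
    simp [← Finset.mul_sum]
    ring

/-- The second (electrode) component of an element of `𝓗¹`, the ground level being chosen so that
it has zero mean. -/
def electrodePart {n : ℕ} (Ω : Set (Space n)) (M : ℕ) : QuotH Ω M →ₗ[ℂ] Diamond M :=
  (Consts Ω M).liftQ
    ((removeMean M).comp ((LinearMap.snd ℂ (H1 Ω) (EuclideanSpace ℂ (Fin M))).comp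
      (WithLp.linearEquiv 2 ℂ (H1 Ω × EuclideanSpace ℂ (Fin M))).toLinearMap))
    (by
      rintro x ⟨c, -, hc⟩
      rw [LinearMap.mem_ker]
      ext m
      have hM : (M : ℂ) ≠ 0 := by exact_mod_cast (Fin.pos m).ne'
      simp [removeMean, show ∀ m, (WithLp.snd x).ofLp m = c from hc, hM])

open Classical in
/-- The electrode potential map `(σ, ζ, I) ↦ U(σ, ζ, I)`: the zero-mean electrode component of the
solution of the forward problem (and `0` where there is no solution). -/
def potentialMap {n M : ℕ} {Ω : Set (Space n)} (E : Fin M → Set (Space n)) (σ : LinfDom Ω)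
    (ζ : LinfE Ω E) (I : Diamond M) : Diamond M :=
  if h : ∃ p : QuotH Ω M, SolvesForward E σ ζ I p then electrodePart Ω M h.choose else 0

end EIT

end

/-! Coercivity turns the problem into the inversion of a bounded operator. The form `sesq` is linear
in (σ, ζ) and vanishes when either argument is a pair (c, c𝟏), so on a Hilbert space K isometric to
𝓗¹ it reads ⟪πy, A(σ,ζ) πx⟫ with A bounded and linear in (σ, ζ). The forward problem becomes A(σ,ζ)
k = ℓ(I), uniquely solvable by Lax–Milgram, and the potential is a bounded linear image of k.
`exists_quotient_model` and `exists_hilbertModel` build K, the orthogonal complement of the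
constants.

A perturbation H = A(ω,η) of norm at most c/2 preserves coercivity with constant c/2, hence
openness. If A d = ℓ(J) - H k, the remainder k' - k - d is sent by A + H to -H d. Since d is of
first order, this is a quadratic bound (`CoerciveWith.norm_remainder_le`). For the third property,
the bilinear form without conjugation is symmetric: the auxiliary and forward equations are tested
with conjugates of each other's solutions and compared.

The analytic weight lies in the trace, defined through a closure of smooth pairs. The trace
inequality, obtained along segments transversal to local Lipschitz graphs, gives uniqueness and
boundedness (`exists_trace_inequality`). Density of smooth functions in H¹(Ω) gives existence
(`smoothH1_topologicalClosure`). Density comes from mollifying localized functions with kernels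
shifted along an interior cone, so that the averages at points of Ω do not see the jump of the zero
extension across ∂Ω. -/

open MeasureTheory Topology
open scoped ENNReal

noncomputable section

namespace EIT

/-! ### Graph coordinates, Hausdorff measure and the one-dimensional trace estimate -/

section GraphCoordinates

variable {n : ℕ}

/-- Fubini's theorem for the orthogonal splitting of `ℝⁿ` along a unit vector `e`. -/
lemma lintegral_eq_lintegral_orthogonal_line {e : Space n} (he : ‖e‖ = 1)
    {F : Space n → ℝ≥0∞} (hF : Measurable F) :
    ∫⁻ x, F x = ∫⁻ y : ((Submodule.span ℝ {e})ᗮ : Submodule ℝ (Space n)), ∫⁻ s : ℝ,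
      F ((y : Space n) + s • e) := by
  have h1 := (Submodule.measurePreserving_measurableEquivProd (Submodule.span ℝ {e})
    (0 : Space n)).symm
  rw [InnerProductSpace.euclideanHausdorffMeasure_eq_volume] at h1
  have h2 := h1.lintegral_comp hF
  rw [← h2, Measure.volume_eq_prod, lintegral_prod_symm]
  · refine lintegral_congr fun y => ?_
    have h3 := (LinearIsometryEquiv.toSpanUnitSingleton (𝕜 := ℝ) e he).measurePreserving
    rw [← h3.lintegral_comp_emb
      (LinearIsometryEquiv.toSpanUnitSingleton (𝕜 := ℝ) e he).toHomeomorph.measurableEmbedding]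
    refine lintegral_congr fun s => ?_
    simp [add_comm]
  · exact (hF.comp (MeasurableEquiv.measurable _)).aemeasurable

/-- The normalizing factor depends on d only, so the Lipschitz bound for Hausdorff measure is
unaffected by it. -/
lemma euclideanHausdorffMeasure_image_le {X Y : Type*} [MetricSpace X] [MeasurableSpace X]
    [BorelSpace X] [MetricSpace Y] [MeasurableSpace Y] [BorelSpace Y] {L : NNReal} {G : X → Y}
    (hG : LipschitzWith L G) (d : ℕ) (A : Set X) :
    (Measure.euclideanHausdorffMeasure d : Measure Y) (G '' A) ≤
      (L : ℝ≥0∞) ^ d * (Measure.euclideanHausdorffMeasure d : Measure X) A := by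
  have h := hG.hausdorffMeasure_image_le (d := d) (by positivity) A
  rw [Measure.euclideanHausdorffMeasure_def, Measure.euclideanHausdorffMeasure_def,
    Measure.smul_apply, Measure.smul_apply, ENNReal.smul_def, ENNReal.smul_def, smul_eq_mul,
    smul_eq_mul]
  calc _ ≤ _ := mul_le_mul_right h _
    _ = _ := by rw [ENNReal.rpow_natCast]; ring

/-- The measure restricted to the range is dominated by L^d times the pushforward under G. Only this
inequality is needed to compare surface integrals over a graph with integrals over its base, so no
area formula enters. -/
lemma setLIntegral_range_euclideanHausdorffMeasure_le {X Y : Type*} [MetricSpace X]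
    [MeasurableSpace X] [BorelSpace X] [MetricSpace Y] [MeasurableSpace Y] [BorelSpace Y]
    {L : NNReal} {G : X → Y} (hG : LipschitzWith L G) (d : ℕ) {f : Y → ℝ≥0∞}
    (hf : Measurable f) :
    ∫⁻ y in Set.range G, f y ∂(Measure.euclideanHausdorffMeasure d) ≤
      (L : ℝ≥0∞) ^ d * ∫⁻ x, f (G x) ∂(Measure.euclideanHausdorffMeasure d) := by
  have hm : (Measure.euclideanHausdorffMeasure d : Measure Y).restrict (Set.range G) ≤
      ((L : ℝ≥0∞) ^ d) • (Measure.euclideanHausdorffMeasure d : Measure X).map G := by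
    refine Measure.le_iff.2 fun S hS => ?_
    rw [Measure.restrict_apply hS, Measure.smul_apply, Measure.map_apply hG.continuous.measurable hS,
      smul_eq_mul, ← Set.image_preimage_eq_inter_range]
    exact euclideanHausdorffMeasure_image_le hG d _
  calc _ ≤ _ := lintegral_mono' hm le_rfl
    _ = _ := by rw [lintegral_smul_measure, lintegral_map hf hG.continuous.measurable, smul_eq_mul]

/-- One-dimensional trace inequality. -/
lemma norm_sq_le_integral {h : ℝ} (hh : 0 < h) {f f' : ℝ → ℂ}
    (hf : ∀ t, HasDerivAt f (f' t) t) (hf' : Continuous f') :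
    ‖f 0‖ ^ 2 ≤ ∫ t in (0 : ℝ)..h, ((1 / h + 1) * ‖f t‖ ^ 2 + ‖f' t‖ ^ 2) := by
  have hfc : Continuous f := continuous_iff_continuousAt.2 fun t => (hf t).continuousAt
  -- The weight 1 - t/h equals 1 at 0 and vanishes at h, so the fundamental theorem of calculus
  -- leaves only the value at 0.
  have hd : ∀ t, HasDerivAt (fun t => (1 - t / h) * ‖f t‖ ^ 2)
      ((-(1 / h)) * ‖f t‖ ^ 2 + (1 - t / h) * (2 * inner ℝ (f t) (f' t))) t := by
    intro t
    have h1 : HasDerivAt (fun t : ℝ => 1 - t / h) (-(1 / h)) t := by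
      simpa using ((hasDerivAt_id t).div_const h).const_sub 1
    exact h1.mul (hf t).norm_sq
  have hcont : Continuous fun t =>
      (-(1 / h)) * ‖f t‖ ^ 2 + (1 - t / h) * (2 * inner ℝ (f t) (f' t)) := by fun_prop
  have hFTC := intervalIntegral.integral_eq_sub_of_hasDerivAt (a := 0) (b := h)
    (fun t _ => hd t) (hcont.intervalIntegrable _ _)
  have h0 : ‖f 0‖ ^ 2 = ∫ t in (0 : ℝ)..h,
      -((-(1 / h)) * ‖f t‖ ^ 2 + (1 - t / h) * (2 * inner ℝ (f t) (f' t))) := by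
    rw [intervalIntegral.integral_neg, hFTC]
    simp [hh.ne']
  rw [h0]
  refine intervalIntegral.integral_mono_on hh.le (hcont.neg.intervalIntegrable _ _)
    (Continuous.intervalIntegrable (by fun_prop) _ _) fun t ht => ?_
  have hw0 : 0 ≤ 1 - t / h := by rw [sub_nonneg, div_le_one hh]; exact ht.2
  have hw1 : 1 - t / h ≤ 1 := by
    have : 0 ≤ t / h := div_nonneg ht.1 hh.le
    linarith
  have hin : |inner ℝ (f t) (f' t)| ≤ ‖f t‖ * ‖f' t‖ := abs_real_inner_le_norm _ _
  have h2 : -((1 - t / h) * (2 * inner ℝ (f t) (f' t))) ≤ ‖f t‖ ^ 2 + ‖f' t‖ ^ 2 := by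
    calc _ ≤ (1 - t / h) * (2 * (‖f t‖ * ‖f' t‖)) := by
          have := neg_abs_le (inner ℝ (f t) (f' t))
          nlinarith
      _ ≤ 1 * (2 * (‖f t‖ * ‖f' t‖)) := by gcongr
      _ ≤ _ := by nlinarith [sq_nonneg (‖f t‖ - ‖f' t‖)]
  linarith

lemma enorm_sq_le_lintegral {h : ℝ} (hh : 0 < h) {f f' : ℝ → ℂ}
    (hf : ∀ t, HasDerivAt f (f' t) t) (hf' : Continuous f') :
    ‖f 0‖ₑ ^ 2 ≤ ENNReal.ofReal (1 / h + 1) *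
      ∫⁻ t in Set.Ioc 0 h, (‖f t‖ₑ ^ 2 + ‖f' t‖ₑ ^ 2) := by
  have hfc : Continuous f := continuous_iff_continuousAt.2 fun t => (hf t).continuousAt
  have h1 := norm_sq_le_integral hh hf hf'
  have hk : 1 ≤ 1 / h + 1 := by have : 0 < 1 / h := by positivity
                                linarith
  have hconv : ∀ z : ℂ, ‖z‖ₑ ^ 2 = ENNReal.ofReal (‖z‖ ^ 2) := fun z => by
    rw [ENNReal.ofReal_pow (norm_nonneg _), ofReal_norm]
  rw [hconv, ← lintegral_const_mul _ (by fun_prop)]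
  refine (ENNReal.ofReal_le_ofReal h1).trans ?_
  rw [intervalIntegral.integral_of_le hh.le, ofReal_integral_eq_lintegral_ofReal]
  · refine lintegral_mono fun t => ?_
    rw [hconv, hconv, ← ENNReal.ofReal_add (by positivity) (by positivity),
      ← ENNReal.ofReal_mul (by positivity)]
    refine ENNReal.ofReal_le_ofReal ?_
    nlinarith [sq_nonneg ‖f' t‖]
  · exact (Continuous.intervalIntegrable (by fun_prop) _ _).1
  · exact Filter.Eventually.of_forall fun t => by positivity

lemma eq_orthogonalProjection_add_inner_smul {e : Space n} (he : ‖e‖ = 1) (x : Space n) :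
    x = ((Submodule.span ℝ {e})ᗮ.orthogonalProjectionOnto x : Space n) + (inner ℝ e x : ℝ) • e := by
  have h := Submodule.starProjection_add_starProjection_orthogonal x (K := Submodule.span ℝ {e})
  rw [Submodule.starProjection_unit_singleton ℝ he] at h
  rw [← Submodule.starProjection_apply, add_comm]
  exact h.symm

lemma orthogonalProjection_add_smul {e : Space n}
    (y : ((Submodule.span ℝ {e})ᗮ : Submodule ℝ (Space n))) (s : ℝ) :
    (Submodule.span ℝ {e})ᗮ.orthogonalProjectionOnto ((y : Space n) + s • e) = y := by
  rw [map_add, Submodule.orthogonalProjectionOnto_mem_subspace_eq_self,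
    Submodule.orthogonalProjectionOnto_eq_zero_iff.2, add_zero]
  exact Submodule.le_orthogonal_orthogonal _
    (Submodule.smul_mem _ _ (Submodule.mem_span_singleton_self e))

lemma inner_orthogonal_add_smul {e : Space n} (he : ‖e‖ = 1)
    (y : ((Submodule.span ℝ {e})ᗮ : Submodule ℝ (Space n))) (s : ℝ) :
    inner ℝ e ((y : Space n) + s • e) = s := by
  have h : inner ℝ e (y : Space n) = 0 :=
    (Submodule.mem_orthogonal_singleton_iff_inner_right).1 y.2
  rw [inner_add_right, inner_smul_right, real_inner_self_eq_norm_sq, he, h]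
  simp

lemma finrank_orthogonal_span_singleton {e : Space n} (he : ‖e‖ = 1) :
    Module.finrank ℝ ((Submodule.span ℝ {e})ᗮ : Submodule ℝ (Space n)) = n - 1 := by
  have h := Submodule.finrank_add_finrank_orthogonal (Submodule.span ℝ {e})
  rw [finrank_span_singleton (by rintro rfl; simp at he), finrank_euclideanSpace_fin] at h
  omega

end GraphCoordinates

/-! ### The trace inequality for smooth functions -/

section TraceInequality

variable {n : ℕ} {Ω : Set (Space n)}

/-- A frontier point is outside the open set Ω, hence not above the graph. Were it strictly below,
so would be a whole neighbourhood, which would then miss Ω. -/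
lemma inner_eq_of_mem_frontier {x₀ e : Space n} {r : ℝ}
    {γ : ((Submodule.span ℝ {e})ᗮ : Submodule ℝ (Space n)) → ℝ} (hγ : Continuous γ)
    (hΩ : IsOpen Ω)
    (hgraph : ∀ x ∈ Metric.ball x₀ r,
      (x ∈ Ω ↔ γ ((Submodule.span ℝ {e})ᗮ.orthogonalProjectionOnto x) < inner ℝ e x))
    {x : Space n} (hx : x ∈ frontier Ω) (hxr : x ∈ Metric.ball x₀ r) :
    inner ℝ e x = γ ((Submodule.span ℝ {e})ᗮ.orthogonalProjectionOnto x) := by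
  rw [hΩ.frontier_eq] at hx
  refine le_antisymm (not_lt.1 fun h => hx.2 ((hgraph x hxr).2 h)) (not_lt.1 fun h => ?_)
  have hopen : IsOpen (Metric.ball x₀ r ∩
      {z | inner ℝ e z < γ ((Submodule.span ℝ {e})ᗮ.orthogonalProjectionOnto z)}) :=
    Metric.isOpen_ball.inter (isOpen_lt (by fun_prop) (hγ.comp (by fun_prop)))
  obtain ⟨z, ⟨hz1, hz2⟩, hz3⟩ := mem_closure_iff.1 hx.1 _ hopen ⟨hxr, h⟩
  exact lt_asymm hz2 ((hgraph z hz1).1 hz3)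

/-- Near `x₀` the boundary lies on a graph, and the segment of length r/2 in direction e above a
boundary point of the smaller ball stays in Ω. The one-dimensional estimate on these segments is
integrated over the base hyperplane by Fubini. The graph map is (1 + K)-Lipschitz, which controls
surface measure by Lebesgue measure on the base. -/
lemma exists_local_trace_inequality (hΩ : IsBoundedLipschitzDomain Ω) {x₀ : Space n}
    (hx₀ : x₀ ∈ frontier Ω) :
    ∃ ρ : ℝ, 0 < ρ ∧ ∃ C : ℝ≥0∞, C ≠ ⊤ ∧ ∀ φ : Space n → ℂ, ContDiff ℝ 1 φ →
      ∫⁻ x in frontier Ω ∩ Metric.ball x₀ ρ, ‖φ x‖ₑ ^ 2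
          ∂(Measure.euclideanHausdorffMeasure (n - 1)) ≤
        C * ∫⁻ x in Ω, (‖φ x‖ₑ ^ 2 + ‖fderiv ℝ φ x‖ₑ ^ 2) := by
  obtain ⟨r, hr, e, he, K, γ, hγ, hgraph⟩ := hΩ.lipschitz x₀ hx₀
  let G : ((Submodule.span ℝ {e})ᗮ : Submodule ℝ (Space n)) → Space n := fun y => (y : Space n) + γ y • e
  have hG : LipschitzWith (1 + K) G := by
    have h1 : LipschitzWith K fun y : ((Submodule.span ℝ {e})ᗮ : Submodule ℝ (Space n)) => γ y • e := by
      refine LipschitzWith.of_dist_le_mul fun y z => ?_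
      rw [dist_eq_norm, ← sub_smul, norm_smul, he, mul_one, ← dist_eq_norm]
      exact hγ.dist_le_mul y z
    exact LipschitzWith.subtype_val _ |>.add h1
  refine ⟨r / 2, by positivity, ((1 + K : NNReal) : ℝ≥0∞) ^ (n - 1) *
    ENNReal.ofReal (1 / (r / 2) + 1), ENNReal.mul_ne_top (ENNReal.pow_ne_top ENNReal.coe_ne_top) ENNReal.ofReal_ne_top,
    fun φ hφ => ?_⟩
  have hφc : Continuous φ := hφ.continuous
  have hφd : Continuous (fderiv ℝ φ) := hφ.continuous_fderiv (by simp)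
  set F : Space n → ℝ≥0∞ := fun x => ‖φ x‖ₑ ^ 2 + ‖fderiv ℝ φ x‖ₑ ^ 2 with hF
  have hFm : Measurable F := by
    have h1 : Continuous fun x => ‖φ x‖ₑ ^ 2 := by fun_prop
    have h2 : Continuous fun x => ‖fderiv ℝ φ x‖ₑ ^ 2 := by fun_prop
    exact h1.measurable.add h2.measurable
  -- The graph map lives on the whole hyperplane but describes ∂Ω only near `x₀`; the indicator
  -- discards the rest.
  set f : Space n → ℝ≥0∞ := (Metric.ball x₀ (r / 2)).indicator fun x => ‖φ x‖ₑ ^ 2 with hf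
  have hfm : Measurable f :=
    (Continuous.measurable (by fun_prop)).indicator Metric.isOpen_ball.measurableSet
  have hsub : frontier Ω ∩ Metric.ball x₀ (r / 2) ⊆ Set.range G := by
    rintro x ⟨hx, hxr⟩
    refine ⟨(Submodule.span ℝ {e})ᗮ.orthogonalProjectionOnto x, ?_⟩
    have := inner_eq_of_mem_frontier hγ.continuous hΩ.isOpen hgraph hx
      (Metric.ball_subset_ball (by linarith) hxr)
    simp only [G]
    rw [← this]
    exact (eq_orthogonalProjection_add_inner_smul he x).symm
  have hpoint : ∀ y : ((Submodule.span ℝ {e})ᗮ : Submodule ℝ (Space n)), f (G y) ≤ ENNReal.ofReal (1 / (r / 2) + 1) *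
      ∫⁻ s : ℝ, Ω.indicator F ((y : Space n) + s • e) := by
    intro y
    by_cases hy : G y ∈ Metric.ball x₀ (r / 2)
    swap
    · simp [hf, hy]
    have hderiv : ∀ t : ℝ, HasDerivAt (fun t : ℝ => φ (G y + t • e))
        (fderiv ℝ φ (G y + t • e) e) t := by
      intro t
      have h1 : HasDerivAt (fun t : ℝ => G y + t • e) e t := by
        simpa using ((hasDerivAt_id t).smul_const e).const_add (G y)
      exact ((hφ.differentiable (by simp)) _).hasFDerivAt.comp_hasDerivAt t h1
    have hmain := enorm_sq_le_lintegral (half_pos hr) hderiv (by fun_prop)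
    rw [hf, Set.indicator_of_mem hy]
    simp only [zero_smul, add_zero] at hmain
    refine hmain.trans (mul_le_mul_right ?_ _)
    calc _ ≤ ∫⁻ t in Set.Ioc 0 (r / 2), Ω.indicator F ((y : Space n) + (γ y + t) • e) := by
          refine setLIntegral_mono' measurableSet_Ioc fun t ht => ?_
          have hz : G y + t • e = (y : Space n) + (γ y + t) • e := by
            simp only [G, add_smul, add_assoc]
          have hzΩ : G y + t • e ∈ Ω := by
            have hzr : G y + t • e ∈ Metric.ball x₀ r := by
              rw [Metric.mem_ball, dist_eq_norm] at hy ⊢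
              calc ‖G y + t • e - x₀‖ = ‖(G y - x₀) + t • e‖ := by congr 1; abel
                _ ≤ ‖G y - x₀‖ + ‖t • e‖ := norm_add_le _ _
                _ < r / 2 + r / 2 := by
                  refine add_lt_add_of_lt_of_le hy ?_
                  rw [norm_smul, he, mul_one, Real.norm_of_nonneg ht.1.le]
                  exact ht.2
                _ = r := by ring
            refine (hgraph _ hzr).2 ?_
            rw [hz, orthogonalProjection_add_smul, inner_orthogonal_add_smul he]
            linarith [ht.1]
          rw [← hz, Set.indicator_of_mem hzΩ]
          simp only [hF]
          gcongr
          refine (ContinuousLinearMap.le_opENorm _ _).trans ?_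
          rw [← ofReal_norm e, he]; simp
      _ ≤ ∫⁻ t : ℝ, Ω.indicator F ((y : Space n) + (γ y + t) • e) := setLIntegral_le_lintegral _ _
      _ = _ := lintegral_add_left_eq_self
          (fun s : ℝ => Ω.indicator F ((y : Space n) + s • e)) (γ y)
  calc ∫⁻ x in frontier Ω ∩ Metric.ball x₀ (r / 2), ‖φ x‖ₑ ^ 2
        ∂(Measure.euclideanHausdorffMeasure (n - 1))
      ≤ ∫⁻ x in frontier Ω ∩ Metric.ball x₀ (r / 2), f x
        ∂(Measure.euclideanHausdorffMeasure (n - 1)) := by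
        refine setLIntegral_mono' (isClosed_frontier.measurableSet.inter
          Metric.isOpen_ball.measurableSet) fun x hx => ?_
        rw [hf, Set.indicator_of_mem hx.2]
    _ ≤ ∫⁻ x in Set.range G, f x ∂(Measure.euclideanHausdorffMeasure (n - 1)) :=
        lintegral_mono_set hsub
    _ ≤ ((1 + K : NNReal) : ℝ≥0∞) ^ (n - 1) *
        ∫⁻ y, f (G y) ∂(Measure.euclideanHausdorffMeasure (n - 1)) :=
        setLIntegral_range_euclideanHausdorffMeasure_le hG _ hfm
    _ = ((1 + K : NNReal) : ℝ≥0∞) ^ (n - 1) * ∫⁻ y, f (G y) := by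
        rw [← finrank_orthogonal_span_singleton he,
          InnerProductSpace.euclideanHausdorffMeasure_eq_volume]
    _ ≤ ((1 + K : NNReal) : ℝ≥0∞) ^ (n - 1) * ∫⁻ y : ((Submodule.span ℝ {e})ᗮ : Submodule ℝ (Space n)), ENNReal.ofReal (1 / (r / 2) + 1) *
        ∫⁻ s : ℝ, Ω.indicator F ((y : Space n) + s • e) :=
        mul_le_mul_right (lintegral_mono hpoint) _
    _ = _ := by
        rw [lintegral_const_mul' _ _ ENNReal.ofReal_ne_top,
          ← lintegral_eq_lintegral_orthogonal_line he (hFm.indicator hΩ.isOpen.measurableSet),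
          lintegral_indicator hΩ.isOpen.measurableSet, mul_assoc]

/-- The trace inequality for continuously differentiable functions. -/
lemma exists_trace_inequality (hΩ : IsBoundedLipschitzDomain Ω) :
    ∃ C : ℝ≥0∞, C ≠ ⊤ ∧ ∀ φ : Space n → ℂ, ContDiff ℝ 1 φ →
      ∫⁻ x, ‖φ x‖ₑ ^ 2 ∂(surf Ω) ≤ C * ∫⁻ x in Ω, (‖φ x‖ₑ ^ 2 + ‖fderiv ℝ φ x‖ₑ ^ 2) := by
  have hcpt : IsCompact (frontier Ω) :=
    hΩ.isBounded.isCompact_closure.of_isClosed_subset isClosed_frontier frontier_subset_closure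
  suffices h : ∃ C : ℝ≥0∞, C ≠ ⊤ ∧ ∀ φ : Space n → ℂ, ContDiff ℝ 1 φ →
      ∫⁻ x in frontier Ω ∩ frontier Ω, ‖φ x‖ₑ ^ 2 ∂(Measure.euclideanHausdorffMeasure (n - 1)) ≤
        C * ∫⁻ x in Ω, (‖φ x‖ₑ ^ 2 + ‖fderiv ℝ φ x‖ₑ ^ 2) by
    rwa [Set.inter_self] at h
  -- Compactness of ∂Ω: the estimate is local and stable under finite unions, the constants being
  -- added.
  refine hcpt.induction_on (p := fun S => ∃ C : ℝ≥0∞, C ≠ ⊤ ∧ ∀ φ : Space n → ℂ,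
    ContDiff ℝ 1 φ → ∫⁻ x in frontier Ω ∩ S, ‖φ x‖ₑ ^ 2
      ∂(Measure.euclideanHausdorffMeasure (n - 1)) ≤
        C * ∫⁻ x in Ω, (‖φ x‖ₑ ^ 2 + ‖fderiv ℝ φ x‖ₑ ^ 2)) ?_ ?_ ?_ ?_
  · exact ⟨0, by simp, by simp⟩
  · rintro S T hST ⟨C, hC, h⟩
    exact ⟨C, hC, fun φ hφ => (lintegral_mono_set (by gcongr)).trans (h φ hφ)⟩
  · rintro S T ⟨C, hC, h⟩ ⟨C', hC', h'⟩
    refine ⟨C + C', ENNReal.add_ne_top.2 ⟨hC, hC'⟩, fun φ hφ => ?_⟩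
    rw [Set.inter_union_distrib_left, add_mul]
    exact (lintegral_union_le _ _ _).trans (add_le_add (h φ hφ) (h' φ hφ))
  · intro x hx
    obtain ⟨ρ, hρ, C, hC, h⟩ := exists_local_trace_inequality hΩ hx
    exact ⟨Metric.ball x ρ, mem_nhdsWithin_of_mem_nhds (Metric.ball_mem_nhds x hρ), C, hC, h⟩

/-- The trace inequality for the constant function 1 bounds the area of ∂Ω by a multiple of the
volume of Ω. -/
lemma surf_univ_lt_top (hΩ : IsBoundedLipschitzDomain Ω) : surf Ω Set.univ < ⊤ := by
  obtain ⟨C, hC, h⟩ := exists_trace_inequality hΩ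
  have h1 := h (fun _ => 1) contDiff_const
  have h2 : (volume Ω) < ⊤ := hΩ.isBounded.measure_lt_top
  have h0 : ∀ x : Space n, ‖fderiv ℝ (fun _ : Space n => (1 : ℂ)) x‖ₑ = 0 := fun x => by
    rw [fderiv_fun_const, Pi.zero_apply, ← ofReal_norm, norm_zero, ENNReal.ofReal_zero]
  simp only [h0, enorm_one] at h1
  norm_num at h1
  rw [Measure.restrict_apply_univ]
  exact h1.trans_lt (ENNReal.mul_lt_top hC.lt_top h2)

end TraceInequality

/-! ### The space H¹(Ω): uniqueness of gradients, completeness, conjugation -/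

section WeakGradient

variable {n : ℕ} {Ω : Set (Space n)}

lemma IsWeakGradient.congr {f f' : Space n → ℂ} {g g' : Space n → EuclideanSpace ℂ (Fin n)}
    (h : IsWeakGradient Ω f g) (hf : f =ᵐ[vol Ω] f') (hg : g =ᵐ[vol Ω] g') :
    IsWeakGradient Ω f' g' := by
  intro φ hφ hs hΩ i
  have h1 : ∫ x in Ω, ((fderiv ℝ φ x (EuclideanSpace.single i 1) : ℝ) : ℂ) * f' x =
      ∫ x in Ω, ((fderiv ℝ φ x (EuclideanSpace.single i 1) : ℝ) : ℂ) * f x :=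
    integral_congr_ae (by filter_upwards [hf] with x hx; rw [hx])
  have h2 : ∫ x in Ω, ((φ x : ℝ) : ℂ) * g' x i = ∫ x in Ω, ((φ x : ℝ) : ℂ) * g x i :=
    integral_congr_ae (by filter_upwards [hg] with x hx; rw [hx])
  rw [h1, h2]
  exact h φ hφ hs hΩ i

/-- The element of `H¹(Ω)` given by a function and its weak gradient. -/
def H1.of {f : Space n → ℂ} {g : Space n → EuclideanSpace ℂ (Fin n)} (hf : MemLp f 2 (vol Ω))
    (hg : MemLp g 2 (vol Ω)) (h : IsWeakGradient Ω f g) : H1 Ω :=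
  ⟨WithLp.toLp 2 (hf.toLp f, hg.toLp g), h.congr hf.coeFn_toLp.symm hg.coeFn_toLp.symm⟩

lemma valH1_of {f : Space n → ℂ} {g : Space n → EuclideanSpace ℂ (Fin n)} (hf : MemLp f 2 (vol Ω))
    (hg : MemLp g 2 (vol Ω)) (h : IsWeakGradient Ω f g) : valH1 (H1.of hf hg h) =ᵐ[vol Ω] f :=
  hf.coeFn_toLp

lemma gradH1_of {f : Space n → ℂ} {g : Space n → EuclideanSpace ℂ (Fin n)}
    (hf : MemLp f 2 (vol Ω)) (hg : MemLp g 2 (vol Ω)) (h : IsWeakGradient Ω f g) :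
    gradH1 (H1.of hf hg h) =ᵐ[vol Ω] g :=
  hg.coeFn_toLp

@[simp] lemma valH1_sub (v w : H1 Ω) : valH1 (v - w) = valH1 v - valH1 w := rfl
@[simp] lemma gradH1_sub (v w : H1 Ω) : gradH1 (v - w) = gradH1 v - gradH1 w := rfl

lemma norm_sq_H1 (v : H1 Ω) : ‖v‖ ^ 2 = ‖valH1 v‖ ^ 2 + ‖gradH1 v‖ ^ 2 :=
  WithLp.prod_norm_sq_eq_of_L2 v.1

lemma norm_H1_le (v : H1 Ω) : ‖v‖ ≤ ‖valH1 v‖ + ‖gradH1 v‖ := by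
  have := norm_sq_H1 v
  have h1 := norm_nonneg (valH1 v)
  have h2 := norm_nonneg (gradH1 v)
  have h3 := norm_nonneg v
  nlinarith [mul_nonneg h1 h2]

/-- The weak gradient is unique. -/
lemma IsWeakGradient.ae_eq (hΩ : IsOpen Ω) {f : Space n → ℂ}
    {g g' : Space n → EuclideanSpace ℂ (Fin n)} (hg : MemLp g 2 (vol Ω)) (hg' : MemLp g' 2 (vol Ω))
    (h : IsWeakGradient Ω f g) (h' : IsWeakGradient Ω f g') : g =ᵐ[vol Ω] g' := by
  have key : ∀ i : Fin n, ∀ᵐ x ∂(volume : Measure (Space n)), x ∈ Ω → g x i - g' x i = 0 := by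
    intro i
    have hgi : MemLp (fun x => g x i) 2 (vol Ω) :=
      (EuclideanSpace.proj i : EuclideanSpace ℂ (Fin n) →L[ℂ] ℂ).comp_memLp' hg
    have hgi' : MemLp (fun x => g' x i) 2 (vol Ω) :=
      (EuclideanSpace.proj i : EuclideanSpace ℂ (Fin n) →L[ℂ] ℂ).comp_memLp' hg'
    refine hΩ.ae_eq_zero_of_integral_contDiff_smul_eq_zero (μ := volume)
      (f := fun x => g x i - g' x i) ?_ fun φ hφ hs hsub => ?_
    · exact locallyIntegrableOn_of_locallyIntegrable_restrict
        ((hgi.sub hgi').locallyIntegrable (by norm_num))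
    · have e : ∫ x, φ x • (g x i - g' x i) = ∫ x in Ω, φ x • (g x i - g' x i) := by
        symm
        refine setIntegral_eq_integral_of_forall_compl_eq_zero fun x hx => ?_
        rw [image_eq_zero_of_notMem_tsupport fun hx' => hx (hsub hx'), zero_smul]
      rw [e]
      have h1 := h φ hφ hs hsub i
      have h2 := h' φ hφ hs hsub i
      rw [h1, neg_inj] at h2
      have hi1 := integrable_test_mul Ω hφ.continuous hs hgi
      have hi2 := integrable_test_mul Ω hφ.continuous hs hgi'
      have : ∀ x, φ x • (g x i - g' x i) = (φ x : ℂ) * g x i - (φ x : ℂ) * g' x i := fun x => by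
        rw [Complex.real_smul]; ring
      simp_rw [this]
      rw [integral_sub hi1 hi2, h2, sub_self]
  rw [Filter.EventuallyEq, ae_restrict_iff' hΩ.measurableSet]
  filter_upwards [ae_all_iff.2 key] with x hx hxΩ
  ext i
  exact sub_eq_zero.1 (hx i hxΩ)

lemma isWeakGradient_H1 (v : H1 Ω) : IsWeakGradient Ω (valH1 v) (gradH1 v) := v.2

/-- The gradient is stored as data but determined by the function, so equalities in H¹(Ω) need only
be checked on values. -/
lemma H1.ext_val (hΩ : IsOpen Ω) {v w : H1 Ω} (h : valH1 v =ᵐ[vol Ω] valH1 w) : v = w := by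
  have h1 : valH1 v = valH1 w := Lp.ext h
  have h2 : gradH1 v = gradH1 w := Lp.ext <|
    IsWeakGradient.ae_eq hΩ (Lp.memLp _) (Lp.memLp _)
      ((isWeakGradient_H1 v).congr h .rfl) (isWeakGradient_H1 w)
  exact Subtype.ext ((WithLp.ofLp_injective 2) (Prod.ext h1 h2))

/-- The gradient of a function with values in `ℂ`, as a vector in `ℂⁿ`. -/
def gradC (φ : Space n → ℂ) (x : Space n) : EuclideanSpace ℂ (Fin n) :=
  WithLp.toLp 2 fun i => fderiv ℝ φ x (EuclideanSpace.single i 1)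

@[simp] lemma gradC_apply (φ : Space n → ℂ) (x : Space n) (i : Fin n) :
    gradC φ x i = fderiv ℝ φ x (EuclideanSpace.single i 1) := rfl

lemma continuous_gradC {φ : Space n → ℂ} (hφ : ContDiff ℝ 1 φ) : Continuous (gradC φ) := by
  have := hφ.continuous_fderiv (by simp)
  refine (PiLp.continuous_toLp 2 _).comp (continuous_pi fun i => by fun_prop)

lemma memLp_of_continuous_of_isBounded {F : Type*} [NormedAddCommGroup F] {f : Space n → F}
    (hf : Continuous f) (hb : Bornology.IsBounded Ω) {p : ℝ≥0∞} : MemLp f p (vol Ω) := by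
  have : IsFiniteMeasure (vol Ω) := ⟨by simpa using hb.measure_lt_top⟩
  obtain ⟨C, hC⟩ := hb.isCompact_closure.exists_bound_of_continuousOn hf.continuousOn
  refine MemLp.of_bound hf.aestronglyMeasurable C ?_
  have h0 : ∀ᵐ x ∂(volume.restrict (closure Ω)), ‖f x‖ ≤ C :=
    ae_restrict_of_forall_mem isClosed_closure.measurableSet hC
  exact ae_restrict_of_ae_restrict_of_subset subset_closure h0

/-- The test function is supported in Ω, so both integrals extend to the whole space, where
integration by parts has no boundary term. -/
lemma isWeakGradient_gradC {φ : Space n → ℂ} (hφ : ContDiff ℝ 1 φ) :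
    IsWeakGradient Ω φ (gradC φ) := by
  intro ψ hψ hs hsub i
  have hψ1 : ContDiff ℝ 1 ψ := hψ.of_le (by exact_mod_cast le_top)
  have hφd := hφ.continuous_fderiv (by simp)
  have hψd := hψ1.continuous_fderiv (by simp)
  have hφc := hφ.continuous
  have hψc := hψ1.continuous
  have e1 : ∫ x in Ω, ((fderiv ℝ ψ x (EuclideanSpace.single i 1) : ℝ) : ℂ) * φ x =
      ∫ x, fderiv ℝ ψ x (EuclideanSpace.single i 1) • φ x := by
    simp_rw [Complex.real_smul]
    refine setIntegral_eq_integral_of_forall_compl_eq_zero fun x hx => ?_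
    rw [fderiv_of_notMem_tsupport ℝ fun hx' => hx (hsub hx')]
    simp
  have e2 : ∫ x in Ω, ((ψ x : ℝ) : ℂ) * gradC φ x i =
      ∫ x, ψ x • fderiv ℝ φ x (EuclideanSpace.single i 1) := by
    simp_rw [Complex.real_smul]
    refine setIntegral_eq_integral_of_forall_compl_eq_zero fun x hx => ?_
    rw [image_eq_zero_of_notMem_tsupport fun hx' => hx (hsub hx')]
    simp
  rw [e1, e2, integral_smul_fderiv_eq_neg_fderiv_smul_of_integrable, neg_neg]
  · exact Continuous.integrable_of_hasCompactSupport (by fun_prop)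
      ((hs.fderiv_apply ℝ _).smul_right)
  · exact Continuous.integrable_of_hasCompactSupport (by fun_prop) hs.smul_right
  · exact Continuous.integrable_of_hasCompactSupport (by fun_prop) hs.smul_right
  · exact fun x _ => (hψ1.differentiable (by simp)) x
  · exact fun x _ => (hφ.differentiable (by simp)) x

/-- The restriction to `Ω` of a continuously differentiable function, as an element of `H¹(Ω)`. -/
def H1.ofContDiff (hb : Bornology.IsBounded Ω) {φ : Space n → ℂ} (hφ : ContDiff ℝ 1 φ) : H1 Ω :=
  H1.of (memLp_of_continuous_of_isBounded hφ.continuous hb)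
    (memLp_of_continuous_of_isBounded (continuous_gradC hφ) hb) (isWeakGradient_gradC hφ)

lemma valH1_ofContDiff (hb : Bornology.IsBounded Ω) {φ : Space n → ℂ} (hφ : ContDiff ℝ 1 φ) :
    valH1 (H1.ofContDiff hb hφ) =ᵐ[vol Ω] φ := valH1_of _ _ _

lemma gradH1_ofContDiff (hb : Bornology.IsBounded Ω) {φ : Space n → ℂ} (hφ : ContDiff ℝ 1 φ) :
    gradH1 (H1.ofContDiff hb hφ) =ᵐ[vol Ω] gradC φ := gradH1_of _ _ _

lemma continuous_integral_test_mul {ψ : Space n → ℝ} (hc : Continuous ψ)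
    (hs : HasCompactSupport ψ) :
    Continuous fun f : Lp ℂ 2 (vol Ω) => ∫ x in Ω, ((ψ x : ℝ) : ℂ) * f x := by
  have h1 : MemLp (fun x => ((ψ x : ℝ) : ℂ)) 2 (vol Ω) :=
    (Complex.continuous_ofReal.comp hc).memLp_of_hasCompactSupport
      (hs.comp_left Complex.ofReal_zero)
  have h2 : (fun f : Lp ℂ 2 (vol Ω) => ∫ x in Ω, ((ψ x : ℝ) : ℂ) * f x) =
      fun f => (ContinuousLinearMap.mul ℂ ℂ).lpPairing (vol Ω) 2 2 (h1.toLp _) f := by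
    ext f
    rw [ContinuousLinearMap.lpPairing_eq_integral]
    refine integral_congr_ae ?_
    filter_upwards [h1.coeFn_toLp] with x hx
    simp [hx]
  rw [h2]
  exact ContinuousLinearMap.continuous _

/-- Each test function imposes an equation between continuous functionals on L². The resulting
completeness of H¹(Ω) is what Lax–Milgram relies on. -/
lemma isClosed_H1 : IsClosed (H1 Ω : Set (L2Pair Ω)) := by
  have : (H1 Ω : Set (L2Pair Ω)) = ⋂ (φ : Space n → ℝ)
      (_ : ContDiff ℝ ((⊤ : ℕ∞) : WithTop ℕ∞) φ) (_ : HasCompactSupport φ)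
      (_ : tsupport φ ⊆ Ω) (i : Fin n), {p : L2Pair Ω |
        ∫ x in Ω, ((fderiv ℝ φ x (EuclideanSpace.single i 1) : ℝ) : ℂ) * p.fst x
        = - ∫ x in Ω, ((φ x : ℝ) : ℂ) * p.snd x i} := by
    ext p
    simp only [Set.mem_iInter]
    rfl
  rw [this]
  refine isClosed_iInter fun φ => isClosed_iInter fun hφ => isClosed_iInter fun hs =>
    isClosed_iInter fun _ => isClosed_iInter fun i => isClosed_eq ?_ ?_
  · exact (continuous_integral_test_mul ((hφ.continuous_fderiv (by simp)).clm_apply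
      continuous_const) (hs.fderiv_apply ℝ _)).comp (WithLp.prod_continuous_ofLp 2 _ _).fst
  · have h1 : (fun p : L2Pair Ω => - ∫ x in Ω, ((φ x : ℝ) : ℂ) * p.snd x i) = fun p : L2Pair Ω =>
        - ∫ x in Ω, ((φ x : ℝ) : ℂ) *
          (EuclideanSpace.proj i : EuclideanSpace ℂ (Fin n) →L[ℂ] ℂ).compLpL 2 (vol Ω) p.snd x := by
      ext p
      congr 1
      refine integral_congr_ae ?_
      filter_upwards [(EuclideanSpace.proj i : EuclideanSpace ℂ (Fin n) →L[ℂ] ℂ).coeFn_compLpL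
        p.snd] with x hx
      rw [hx]; rfl
    rw [h1]
    exact ((continuous_integral_test_mul hφ.continuous hs).comp
      ((ContinuousLinearMap.continuous _).comp (WithLp.prod_continuous_ofLp 2 _ _).snd)).neg

instance : CompleteSpace (H1 Ω) := isClosed_H1.completeSpace_coe

/-- Complex conjugation on `ℂⁿ`. -/
def conjVec (n : ℕ) : EuclideanSpace ℂ (Fin n) →L[ℝ] EuclideanSpace ℂ (Fin n) :=
  (LinearIsometryEquiv.piLpCongrRight 2 fun _ : Fin n => Complex.conjLIE).toContinuousLinearEquiv

@[simp] lemma conjVec_apply (z : EuclideanSpace ℂ (Fin n)) (i : Fin n) :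
    conjVec n z i = starRingEnd ℂ (z i) := rfl

/-- Test functions are real, so the defining identity can be conjugated term by term. -/
lemma isWeakGradient_conj {f : Space n → ℂ} {g : Space n → EuclideanSpace ℂ (Fin n)}
    (h : IsWeakGradient Ω f g) :
    IsWeakGradient Ω (fun x => starRingEnd ℂ (f x)) (fun x => conjVec n (g x)) := by
  intro φ hφ hs hsub i
  have h1 := congrArg (starRingEnd ℂ) (h φ hφ hs hsub i)
  rw [map_neg, ← integral_conj, ← integral_conj] at h1
  simpa using h1

/-- Complex conjugation on `H¹(Ω)`. -/
def conjH1 (v : H1 Ω) : H1 Ω :=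
  ⟨WithLp.toLp 2 ((Complex.conjCLE : ℂ →L[ℝ] ℂ).compLpL 2 (vol Ω) (valH1 v),
    (conjVec n).compLpL 2 (vol Ω) (gradH1 v)),
    (isWeakGradient_conj (isWeakGradient_H1 v)).congr
      ((Complex.conjCLE : ℂ →L[ℝ] ℂ).coeFn_compLpL _).symm ((conjVec n).coeFn_compLpL _).symm⟩

lemma valH1_conjH1 (v : H1 Ω) :
    valH1 (conjH1 v) =ᵐ[vol Ω] fun x => starRingEnd ℂ (valH1 v x) :=
  (Complex.conjCLE : ℂ →L[ℝ] ℂ).coeFn_compLpL _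

lemma gradH1_conjH1 (v : H1 Ω) :
    gradH1 (conjH1 v) =ᵐ[vol Ω] fun x => conjVec n (gradH1 v x) :=
  (conjVec n).coeFn_compLpL _

lemma continuous_valH1 : Continuous (valH1 : H1 Ω → Lp ℂ 2 (vol Ω)) :=
  (WithLp.prod_continuous_ofLp 2 _ _).fst.comp continuous_subtype_val

lemma continuous_gradH1 :
    Continuous (gradH1 : H1 Ω → Lp (EuclideanSpace ℂ (Fin n)) 2 (vol Ω)) :=
  (WithLp.prod_continuous_ofLp 2 _ _).snd.comp continuous_subtype_val

lemma continuous_conjH1 : Continuous (conjH1 : H1 Ω → H1 Ω) := by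
  refine Continuous.subtype_mk ?_ _
  refine (WithLp.prod_continuous_toLp 2 _ _).comp (Continuous.prodMk ?_ ?_)
  · exact (ContinuousLinearMap.continuous _).comp continuous_valH1
  · exact (ContinuousLinearMap.continuous _).comp continuous_gradH1

end WeakGradient

/-! ### Mollification in L² -/

section Mollification

variable {n : ℕ} {F : Type*} [NormedAddCommGroup F]

/-- Continuity of translations in `L²(ℝⁿ)`. -/
lemma exists_forall_eLpNorm_translate_sub_le {w : Space n → F} (hw : MemLp w 2 volume)
    {ε : ℝ≥0∞} (hε : 0 < ε) :
    ∃ δ : ℝ, 0 < δ ∧ ∀ z : Space n, ‖z‖ < δ →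
      eLpNorm (fun x => w (x - z) - w x) 2 volume ≤ ε := by
  have hmp : ∀ z : Space n, MeasurePreserving (fun x => x - z) volume volume :=
    fun z => measurePreserving_sub_right volume z
  let T : C(Space n × Space n, Space n) := ⟨fun p => p.2 - p.1, by fun_prop⟩
  have hcont : Continuous fun z : Space n =>
      Lp.compMeasurePreserving (E := F) (p := 2) (T.curry z) (hmp z) (hw.toLp w) :=
    Continuous.compMeasurePreservingLp continuous_const T.curry.continuous hmp (by norm_num)
  have h0 : ∀ᶠ z in 𝓝 (0 : Space n),
      edist (Lp.compMeasurePreserving (E := F) (p := 2) (T.curry z) (hmp z) (hw.toLp w))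
        (Lp.compMeasurePreserving (E := F) (p := 2) (T.curry 0) (hmp 0) (hw.toLp w)) < ε :=
    hcont.continuousAt.eventually (Metric.eball_mem_nhds _ hε)
  obtain ⟨δ, hδ, h⟩ := Metric.eventually_nhds_iff.1 h0
  refine ⟨δ, hδ, fun z hz => ?_⟩
  refine le_trans (le_of_eq ?_) (h (y := z) (by simpa using hz)).le
  have hae : ∀ z : Space n, Lp.compMeasurePreserving (E := F) (p := 2) (T.curry z) (hmp z)
      (hw.toLp w) =ᵐ[volume] fun x => w (x - z) := fun z =>
    (Lp.coeFn_compMeasurePreserving _ (hmp z)).trans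
      ((hmp z).quasiMeasurePreserving.ae_eq_comp hw.coeFn_toLp)
  rw [Lp.edist_def]
  refine eLpNorm_congr_ae ?_
  filter_upwards [hae z, hae 0] with x h1 h2
  rw [Pi.sub_apply, h1, h2, sub_zero]

variable [NormedSpace ℝ F]

lemma integrable_smul_translate {ρ : Space n → ℝ} (hc : Continuous ρ) (hs : HasCompactSupport ρ)
    {w : Space n → F} (hw : LocallyIntegrable w volume) (x : Space n) :
    Integrable (fun z => ρ z • w (x - z)) :=
  (hs.convolutionExists_left (ContinuousLinearMap.lsmul ℝ ℝ) hc hw x).integrable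

/-- Mollification with a kernel concentrated near the origin approximates in `L²(ℝⁿ)`. -/
lemma exists_forall_eLpNorm_mollify_sub_le [CompleteSpace F] {w : Space n → F} (hwm : StronglyMeasurable w)
    (hw : MemLp w 2 volume) {ε : ℝ≥0∞} (hε : 0 < ε) :
    ∃ δ : ℝ, 0 < δ ∧ ∀ ρ : Space n → ℝ, Continuous ρ → HasCompactSupport ρ → (∀ z, 0 ≤ ρ z) →
      ∫ z, ρ z = 1 → (∀ z, ρ z ≠ 0 → ‖z‖ < δ) →
      eLpNorm (fun x => (∫ z, ρ z • w (x - z)) - w x) 2 volume ≤ ε := by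
  obtain ⟨δ, hδ, hT⟩ := exists_forall_eLpNorm_translate_sub_le hw hε
  refine ⟨δ, hδ, fun ρ hc hs hpos hint hδρ => ?_⟩
  have hρi : Integrable ρ := hc.integrable_of_hasCompactSupport hs
  have hwl : LocallyIntegrable w volume := hw.locallyIntegrable (by norm_num)
  -- Weighting by ρ gives a probability measure, so the squared average of w(x - z) - w(x) is at
  -- most the average of its square. Exchanging the integrals then reduces the claim to continuity
  -- of translations.
  set ν : Measure (Space n) := volume.withDensity fun z => ENNReal.ofReal (ρ z) with hν
  have hρm : Measurable fun z => ENNReal.ofReal (ρ z) := by fun_prop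
  have hν1 : IsProbabilityMeasure ν := ⟨by
    rw [hν, withDensity_apply _ MeasurableSet.univ, Measure.restrict_univ,
      ← ofReal_integral_eq_lintegral_ofReal hρi (Filter.Eventually.of_forall hpos), hint,
      ENNReal.ofReal_one]⟩
  have hsq : ∀ {μ : Measure (Space n)} (f : Space n → F),
      eLpNorm f 2 μ ^ 2 = ∫⁻ x, ‖f x‖ₑ ^ 2 ∂μ := by
    intro μ f
    have := eLpNorm_nnreal_pow_eq_lintegral (f := f) (μ := μ) (p := 2) (by norm_num)
    simpa using this
  have hpt : ∀ x, ‖(∫ z, ρ z • w (x - z)) - w x‖ₑ ^ 2 ≤ ∫⁻ z, ‖w (x - z) - w x‖ₑ ^ 2 ∂ν := by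
    intro x
    have e1 : (∫ z, ρ z • w (x - z)) - w x = ∫ z, ρ z • (w (x - z) - w x) := by
      simp_rw [smul_sub]
      rw [integral_sub (integrable_smul_translate hc hs hwl x) (hρi.smul_const _),
        integral_smul_const, hint, one_smul]
    have e2 : ∫ z, ρ z • (w (x - z) - w x) = ∫ z, (w (x - z) - w x) ∂ν := by
      rw [hν, integral_withDensity_eq_integral_toReal_smul hρm
        (Filter.Eventually.of_forall fun z => ENNReal.ofReal_lt_top)]
      exact integral_congr_ae (Filter.Eventually.of_forall fun z => by
        simp only [ENNReal.toReal_ofReal (hpos z)])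
    have hm : AEStronglyMeasurable (fun z => w (x - z) - w x) ν :=
      ((hwm.comp_measurable (by fun_prop)).sub stronglyMeasurable_const).aestronglyMeasurable
    rw [e1, e2, ← hsq]
    gcongr
    calc _ ≤ ∫⁻ z, ‖w (x - z) - w x‖ₑ ∂ν := enorm_integral_le_lintegral_enorm _
      _ = eLpNorm (fun z => w (x - z) - w x) 1 ν := eLpNorm_one_eq_lintegral_enorm.symm
      _ ≤ _ := eLpNorm_le_eLpNorm_of_exponent_le (by norm_num) hm
  rw [← ENNReal.pow_le_pow_left_iff two_ne_zero, hsq]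
  calc _ ≤ ∫⁻ x, ∫⁻ z, ‖w (x - z) - w x‖ₑ ^ 2 ∂ν := lintegral_mono hpt
    _ = ∫⁻ z, (∫⁻ x, ‖w (x - z) - w x‖ₑ ^ 2) ∂ν := by
      rw [lintegral_lintegral_swap]
      have h1 : StronglyMeasurable fun p : Space n × Space n => w (p.1 - p.2) - w p.1 :=
        (hwm.comp_measurable (measurable_fst.sub measurable_snd)).sub
          (hwm.comp_measurable measurable_fst)
      exact (h1.enorm.pow_const 2).aemeasurable
    _ ≤ ∫⁻ z, ε ^ 2 ∂ν := by
      refine lintegral_mono_ae ?_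
      rw [hν, ae_withDensity_iff hρm]
      refine Filter.Eventually.of_forall fun z hz => ?_
      rw [← hsq]
      gcongr
      exact hT z (hδρ z fun h => hz (by simp [h]))
    _ = ε ^ 2 := by simp

end Mollification

/-! ### Products with smooth functions and their mollified gradients -/

section Cutoff

variable {n : ℕ} {Ω : Set (Space n)}

/-- The gradient of a real function, as a vector in `ℂⁿ`. -/
def gradR (χ : Space n → ℝ) (x : Space n) : EuclideanSpace ℂ (Fin n) :=
  WithLp.toLp 2 fun i => ((fderiv ℝ χ x (EuclideanSpace.single i 1) : ℝ) : ℂ)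

@[simp] lemma gradR_apply (χ : Space n → ℝ) (x : Space n) (i : Fin n) :
    gradR χ x i = ((fderiv ℝ χ x (EuclideanSpace.single i 1) : ℝ) : ℂ) := rfl

lemma continuous_gradR {χ : Space n → ℝ} (hχ : ContDiff ℝ 1 χ) : Continuous (gradR χ) := by
  have := hχ.continuous_fderiv (by simp)
  refine (PiLp.continuous_toLp 2 _).comp (continuous_pi fun i => by fun_prop)

lemma memLp_cutoff_val (hb : Bornology.IsBounded Ω) {χ : Space n → ℝ} (hχ : ContDiff ℝ 1 χ)
    (v : H1 Ω) : MemLp (fun x => χ x • valH1 v x) 2 (vol Ω) :=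
  MemLp.smul (p := ⊤) (q := 2) (Lp.memLp (valH1 v))
    (memLp_of_continuous_of_isBounded hχ.continuous hb)

lemma memLp_cutoff_grad (hb : Bornology.IsBounded Ω) {χ : Space n → ℝ} (hχ : ContDiff ℝ 1 χ)
    (v : H1 Ω) : MemLp (fun x => χ x • gradH1 v x + valH1 v x • gradR χ x) 2 (vol Ω) :=
  MemLp.add (MemLp.smul (p := ⊤) (q := 2) (Lp.memLp (gradH1 v))
      (memLp_of_continuous_of_isBounded hχ.continuous hb))
    (MemLp.smul (p := 2) (q := ⊤) (memLp_of_continuous_of_isBounded (continuous_gradR hχ) hb)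
      (Lp.memLp (valH1 v)))

/-- Testing the weak gradient of `v` with a product. -/
lemma integral_fderiv_mul_cutoff {χ φ : Space n → ℝ}
    (hχ : ContDiff ℝ ((⊤ : ℕ∞) : WithTop ℕ∞) χ) (hφ : ContDiff ℝ ((⊤ : ℕ∞) : WithTop ℕ∞) φ)
    (hs : HasCompactSupport φ ∨ HasCompactSupport χ) (hsub : tsupport (fun x => φ x * χ x) ⊆ Ω)
    (v : H1 Ω) (i : Fin n) :
    ∫ x in Ω, ((fderiv ℝ φ x (EuclideanSpace.single i 1) : ℝ) : ℂ) * (χ x • valH1 v x) =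
      - ∫ x in Ω, ((φ x : ℝ) : ℂ) * (χ x • gradH1 v x + valH1 v x • gradR χ x) i := by
  have hsφχ : HasCompactSupport fun x => φ x * χ x := hs.elim (fun h => h.mul_right) fun h => h.mul_left
  -- The product φχ is an admissible test function, and the product rule splits its derivative into
  -- the two required terms.
  have h := isWeakGradient_H1 v _ (hφ.mul hχ) hsφχ hsub i
  have hφd := hφ.continuous_fderiv (by simp)
  have hχd := hχ.continuous_fderiv (by simp)
  have hφc := hφ.continuous
  have hχc := hχ.continuous
  have hfd : ∀ x, fderiv ℝ (fun x => φ x * χ x) x (EuclideanSpace.single i 1) =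
      fderiv ℝ φ x (EuclideanSpace.single i 1) * χ x +
        φ x * fderiv ℝ χ x (EuclideanSpace.single i 1) := by
    intro x
    rw [fderiv_fun_mul ((hφ.differentiable (by simp)) x) ((hχ.differentiable (by simp)) x)]
    simp
    ring
  have hs1 : HasCompactSupport fun x => fderiv ℝ φ x (EuclideanSpace.single i 1) * χ x :=
    hs.elim (fun h => (h.fderiv_apply ℝ _).mul_right) fun h => h.mul_left
  have hs2 : HasCompactSupport fun x => φ x * fderiv ℝ χ x (EuclideanSpace.single i 1) :=
    hs.elim (fun h => h.mul_right) fun h => (h.fderiv_apply ℝ _).mul_left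
  have i1 := integrable_test_mul Ω (by fun_prop) hs1 (Lp.memLp (valH1 v))
  have i2 := integrable_test_mul Ω (by fun_prop) hs2 (Lp.memLp (valH1 v))
  have i3 := integrable_test_mul Ω (by fun_prop) hsφχ (memLp_coord (gradH1 v) i)
  simp_rw [hfd] at h
  have e1 : ∫ x in Ω, ((fderiv ℝ φ x (EuclideanSpace.single i 1) * χ x +
      φ x * fderiv ℝ χ x (EuclideanSpace.single i 1) : ℝ) : ℂ) * valH1 v x =
      (∫ x in Ω, ((fderiv ℝ φ x (EuclideanSpace.single i 1) * χ x : ℝ) : ℂ) * valH1 v x) +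
      ∫ x in Ω, ((φ x * fderiv ℝ χ x (EuclideanSpace.single i 1) : ℝ) : ℂ) * valH1 v x := by
    rw [← integral_add i1 i2]
    refine integral_congr_ae (Filter.Eventually.of_forall fun x => ?_)
    simp only [Complex.ofReal_add]; ring
  have e2 : ∫ x in Ω, ((φ x : ℝ) : ℂ) * (χ x • gradH1 v x + valH1 v x • gradR χ x) i =
      (∫ x in Ω, ((φ x * χ x : ℝ) : ℂ) * gradH1 v x i) +
      ∫ x in Ω, ((φ x * fderiv ℝ χ x (EuclideanSpace.single i 1) : ℝ) : ℂ) * valH1 v x := by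
    rw [← integral_add i3 i2]
    refine integral_congr_ae (Filter.Eventually.of_forall fun x => ?_)
    simp only [PiLp.add_apply, PiLp.smul_apply, gradR_apply, Complex.real_smul, smul_eq_mul,
      Complex.ofReal_mul]
    ring
  have e3 : ∫ x in Ω, ((fderiv ℝ φ x (EuclideanSpace.single i 1) : ℝ) : ℂ) *
      (χ x • valH1 v x) =
      ∫ x in Ω, ((fderiv ℝ φ x (EuclideanSpace.single i 1) * χ x : ℝ) : ℂ) * valH1 v x := by
    refine integral_congr_ae (Filter.Eventually.of_forall fun x => ?_)
    simp only [Complex.real_smul, Complex.ofReal_mul]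
    ring
  rw [e1] at h
  rw [e2, e3, neg_add, ← h]
  ring

/-- The product of an element of `H¹(Ω)` with a smooth function. -/
def cutoffH1 (hb : Bornology.IsBounded Ω) {χ : Space n → ℝ}
    (hχ : ContDiff ℝ ((⊤ : ℕ∞) : WithTop ℕ∞) χ) (v : H1 Ω) : H1 Ω :=
  H1.of (memLp_cutoff_val hb (hχ.of_le (by exact_mod_cast le_top)) v)
    (memLp_cutoff_grad hb (hχ.of_le (by exact_mod_cast le_top)) v) fun _ hφ hs hsub i =>
      integral_fderiv_mul_cutoff hχ hφ (Or.inl hs) ((tsupport_mul_subset_left).trans hsub) v i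

lemma valH1_cutoffH1 (hb : Bornology.IsBounded Ω) {χ : Space n → ℝ}
    (hχ : ContDiff ℝ ((⊤ : ℕ∞) : WithTop ℕ∞) χ) (v : H1 Ω) :
    valH1 (cutoffH1 hb hχ v) =ᵐ[vol Ω] fun x => χ x • valH1 v x := valH1_of _ _ _

lemma gradH1_cutoffH1 (hb : Bornology.IsBounded Ω) {χ : Space n → ℝ}
    (hχ : ContDiff ℝ ((⊤ : ℕ∞) : WithTop ℕ∞) χ) (v : H1 Ω) :
    gradH1 (cutoffH1 hb hχ v) =ᵐ[vol Ω] fun x => χ x • gradH1 v x + valH1 v x • gradR χ x :=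
  gradH1_of _ _ _

/-- The gradient of a mollification of `χ v` at a point near which the kernel, multiplied by `χ`,
only sees `Ω`. -/
lemma gradC_mollify (hΩ : IsOpen Ω) (hb : Bornology.IsBounded Ω) {χ : Space n → ℝ}
    (hχ : ContDiff ℝ ((⊤ : ℕ∞) : WithTop ℕ∞) χ) {ρ : Space n → ℝ}
    (hρ : ContDiff ℝ ((⊤ : ℕ∞) : WithTop ℕ∞) ρ) (hρs : HasCompactSupport ρ) (v : H1 Ω)
    {x : Space n} (hx : ∀ y ∈ tsupport χ, x - y ∈ tsupport ρ → y ∈ Ω) :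
    gradC (fun x => ∫ z, ρ z • Ω.indicator (fun y => χ y • valH1 v y) (x - z)) x =
      ∫ z, ρ z • Ω.indicator (fun y => χ y • gradH1 v y + valH1 v y • gradR χ y) (x - z) := by
  have hχ1 : ContDiff ℝ 1 χ := hχ.of_le (by exact_mod_cast le_top)
  have hρ1 : ContDiff ℝ 1 ρ := hρ.of_le (by exact_mod_cast le_top)
  set w : Space n → ℂ := Ω.indicator fun y => χ y • valH1 v y with hw
  set G : Space n → EuclideanSpace ℂ (Fin n) :=
    Ω.indicator fun y => χ y • gradH1 v y + valH1 v y • gradR χ y with hG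
  have hwl : LocallyIntegrable w :=
    ((memLp_indicator_iff_restrict hΩ.measurableSet).2
      (memLp_cutoff_val hb hχ1 v)).locallyIntegrable (by norm_num)
  have hGl : LocallyIntegrable G :=
    ((memLp_indicator_iff_restrict hΩ.measurableSet).2
      (memLp_cutoff_grad hb hχ1 v)).locallyIntegrable (by norm_num)
  ext i
  have hF := (hρs.hasFDerivAt_convolution_left (ContinuousLinearMap.lsmul ℝ ℝ) hρ1 hwl x).fderiv
  have hρd := hρ1.continuous_fderiv (by simp)
  have hex := ((hρs.fderiv ℝ).convolutionExists_left
    ((ContinuousLinearMap.lsmul ℝ ℝ).precompL (Space n)) hρd hwl x).integrable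
  have e1 : gradC (fun x => ∫ z, ρ z • w (x - z)) x i =
      ∫ z, fderiv ℝ ρ z (EuclideanSpace.single i 1) • w (x - z) := by
    rw [gradC_apply]
    change fderiv ℝ (convolution ρ w (ContinuousLinearMap.lsmul ℝ ℝ) volume) x _ = _
    rw [hF]
    rw [convolution_def, ContinuousLinearMap.integral_apply hex]
    rfl
  have e2 : (∫ z, ρ z • G (x - z)) i = ∫ z, ρ z • G (x - z) i :=
    ((EuclideanSpace.proj i : EuclideanSpace ℂ (Fin n) →L[ℂ] ℂ).integral_comp_comm
      (integrable_smul_translate hρ.continuous hρs hGl x)).symm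
  rw [e1, e2, ← integral_sub_left_eq_self _ volume x, ← integral_sub_left_eq_self
    (fun z => ρ z • G (x - z) i) volume x]
  simp only [sub_sub_cancel]
  -- After the change of variable, y ↦ ρ(x - y) serves as test function. By `hx` its product with χ
  -- is supported in Ω, so the zero extension contributes no boundary term. Its derivative in y
  -- carries a minus sign, which cancels that of integration by parts.
  have hφ : ContDiff ℝ ((⊤ : ℕ∞) : WithTop ℕ∞) fun y => ρ (x - y) :=
    hρ.comp (contDiff_const.sub contDiff_id)
  have hφs : HasCompactSupport fun y => ρ (x - y) :=
    hρs.comp_homeomorph (Homeomorph.subLeft x)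
  have hsub : tsupport (fun y => ρ (x - y) * χ y) ⊆ Ω := by
    intro y hy
    refine hx y (tsupport_mul_subset_right hy) ?_
    have h1 := tsupport_mul_subset_left hy
    exact tsupport_comp_subset_preimage ρ (f := fun y => x - y) (by fun_prop) h1
  have key := integral_fderiv_mul_cutoff hχ hφ (Or.inl hφs) hsub v i
  have hfd : ∀ y, fderiv ℝ (fun y => ρ (x - y)) y (EuclideanSpace.single i 1) =
      - fderiv ℝ ρ (x - y) (EuclideanSpace.single i 1) := by
    intro y
    have h1 : HasFDerivAt (fun y => ρ (x - y)) _ y :=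
      (hρ1.differentiable (by simp) (x - y)).hasFDerivAt.comp y ((hasFDerivAt_id y).const_sub x)
    rw [h1.fderiv]
    simp
  simp_rw [hfd, Complex.ofReal_neg, neg_mul, integral_neg, neg_inj] at key
  have e3 : ∫ y, fderiv ℝ ρ (x - y) (EuclideanSpace.single i 1) • w y =
      ∫ y in Ω, ((fderiv ℝ ρ (x - y) (EuclideanSpace.single i 1) : ℝ) : ℂ) *
        (χ y • valH1 v y) := by
    rw [← integral_indicator hΩ.measurableSet]
    refine integral_congr_ae (Filter.Eventually.of_forall fun y => ?_)
    by_cases hy : y ∈ Ω <;> simp [hw, hy]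
  have e4 : ∫ y, ρ (x - y) • G y i = ∫ y in Ω, ((ρ (x - y) : ℝ) : ℂ) *
      (χ y • gradH1 v y + valH1 v y • gradR χ y) i := by
    rw [← integral_indicator hΩ.measurableSet]
    refine integral_congr_ae (Filter.Eventually.of_forall fun y => ?_)
    by_cases hy : y ∈ Ω <;> simp [hG, hy, mul_add]
  rw [e3, e4, key]

end Cutoff

/-! ### Density of smooth functions in H¹(Ω) -/

section Density

variable {n : ℕ} {Ω : Set (Space n)}

/-- Every point of `closure Ω` has a ball in which `Ω` contains a cone of fixed opening over each
of its points. -/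
lemma exists_local_cone (hΩ : IsBoundedLipschitzDomain Ω) {x₀ : Space n}
    (hx₀ : x₀ ∈ closure Ω) :
    ∃ r : ℝ, 0 < r ∧ ∃ e : Space n, ‖e‖ ≤ 1 ∧ ∃ κ : ℝ, 0 < κ ∧ κ ≤ 1 ∧ ∃ T : ℝ, 0 < T ∧
      ∀ t : ℝ, 0 < t → t < T → ∀ x ∈ Ω, ∀ b : Space n, ‖b‖ ≤ κ * t →
        x + t • e + b ∈ Metric.ball x₀ r → x + t • e + b ∈ Ω := by
  by_cases hx : x₀ ∈ Ω
  · obtain ⟨r, hr, hsub⟩ := Metric.isOpen_iff.1 hΩ.isOpen x₀ hx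
    -- At an interior point the ball itself lies in Ω, so the direction and the cone constants are
    -- irrelevant.
    exact ⟨r, hr, 0, by simp, 1, one_pos, le_rfl, 1, one_pos, fun _ _ _ _ _ _ _ h => hsub h⟩
  obtain ⟨r, hr, e, he, K, γ, hγ, hgraph⟩ := hΩ.lipschitz x₀
    (by rw [hΩ.isOpen.frontier_eq]; exact ⟨hx₀, hx⟩)
  have hK : (0 : ℝ) < K + 1 := by positivity
  -- Moving by t • e gains height t. Adding b loses at most ‖b‖ in height and raises the graph by at
  -- most K‖b‖, so ‖b‖ ≤ t/(K+1) suffices. With t < r/4 the total displacement is below r/2, which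
  -- keeps x in the ball of radius r.
  refine ⟨r / 2, by positivity, e, he.le, 1 / (K + 1), by positivity, ?_, r / 4, by positivity,
    fun t ht htT x hxΩ b hb hball => ?_⟩
  · rw [div_le_one hK]; linarith [K.coe_nonneg]
  have hbt : (K + 1) * ‖b‖ ≤ t := by
    calc _ ≤ (K + 1) * (1 / (K + 1) * t) := by gcongr
      _ = t := by field_simp
  have hbt' : ‖b‖ ≤ t := by nlinarith [norm_nonneg b, K.coe_nonneg]
  have hyr : x + t • e + b ∈ Metric.ball x₀ r := Metric.ball_subset_ball (by linarith) hball
  have hxr : x ∈ Metric.ball x₀ r := by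
    rw [Metric.mem_ball, dist_eq_norm] at hball ⊢
    calc ‖x - x₀‖ = ‖(x + t • e + b - x₀) - (t • e + b)‖ := by congr 1; abel
      _ ≤ ‖x + t • e + b - x₀‖ + (‖t • e‖ + ‖b‖) :=
        (norm_sub_le _ _).trans (add_le_add_right (norm_add_le _ _) _)
      _ < r / 2 + (r / 4 + r / 4) := by
        rw [norm_smul, he, mul_one, Real.norm_of_nonneg ht.le]
        linarith
      _ = r := by ring
  have h1 := (hgraph x hxr).1 hxΩ
  refine (hgraph _ hyr).2 ?_
  have hproj : (Submodule.span ℝ {e})ᗮ.orthogonalProjectionOnto (x + t • e + b) =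
      (Submodule.span ℝ {e})ᗮ.orthogonalProjectionOnto x +
        (Submodule.span ℝ {e})ᗮ.orthogonalProjectionOnto b := by
    rw [map_add, map_add, (Submodule.orthogonalProjectionOnto_eq_zero_iff
      (K := (Submodule.span ℝ {e})ᗮ) (v := t • e)).2, add_zero]
    exact Submodule.le_orthogonal_orthogonal _
      (Submodule.smul_mem _ _ (Submodule.mem_span_singleton_self e))
  have hP : ‖(Submodule.span ℝ {e})ᗮ.orthogonalProjectionOnto b‖ ≤ ‖b‖ :=
    Submodule.norm_orthogonalProjectionOnto_apply_le _ _
  have h2 : γ ((Submodule.span ℝ {e})ᗮ.orthogonalProjectionOnto x +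
        (Submodule.span ℝ {e})ᗮ.orthogonalProjectionOnto b) ≤
      γ ((Submodule.span ℝ {e})ᗮ.orthogonalProjectionOnto x) + K * ‖b‖ := by
    have h3 := hγ.dist_le_mul ((Submodule.span ℝ {e})ᗮ.orthogonalProjectionOnto x +
        (Submodule.span ℝ {e})ᗮ.orthogonalProjectionOnto b)
        ((Submodule.span ℝ {e})ᗮ.orthogonalProjectionOnto x)
    rw [dist_eq_norm, dist_eq_norm, add_sub_cancel_left, Real.norm_eq_abs] at h3
    have := mul_le_mul_of_nonneg_left hP K.coe_nonneg
    linarith [le_abs_self (γ ((Submodule.span ℝ {e})ᗮ.orthogonalProjectionOnto x +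
        (Submodule.span ℝ {e})ᗮ.orthogonalProjectionOnto b) -
        γ ((Submodule.span ℝ {e})ᗮ.orthogonalProjectionOnto x))]
  have h4 : -‖b‖ ≤ inner ℝ e b := by
    have := abs_real_inner_le_norm e b
    rw [he, one_mul] at this
    exact (abs_le.1 this).1
  rw [hproj, inner_add_right, inner_add_right, inner_smul_right, real_inner_self_eq_norm_sq, he]
  linarith

/-- The elements of `H¹(Ω)` that are restrictions of smooth functions on `ℝⁿ`. -/
def smoothH1 (Ω : Set (Space n)) : Submodule ℂ (H1 Ω) where
  carrier := {v | ∃ φ : Space n → ℂ, ContDiff ℝ ((⊤ : ℕ∞) : WithTop ℕ∞) φ ∧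
    valH1 v =ᵐ[vol Ω] φ}
  zero_mem' := ⟨fun _ => 0, contDiff_const, Lp.coeFn_zero ℂ 2 (vol Ω)⟩
  add_mem' := by
    rintro v w ⟨φ, hφ, h⟩ ⟨ψ, hψ, h'⟩
    exact ⟨_, hφ.add hψ, (Lp.coeFn_add _ _).trans (h.add h')⟩
  smul_mem' := by
    rintro c v ⟨φ, hφ, h⟩
    refine ⟨fun x => c • φ x, hφ.const_smul c, (Lp.coeFn_smul c (valH1 v)).trans ?_⟩
    filter_upwards [h] with x hx
    simp [hx]

/-- A smooth averaging kernel supported in the closed ball of radius `s` around `c`. -/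
lemma exists_kernel (c : Space n) {s : ℝ} (hs : 0 < s) :
    ∃ ρ : Space n → ℝ, ContDiff ℝ ((⊤ : ℕ∞) : WithTop ℕ∞) ρ ∧ HasCompactSupport ρ ∧
      (∀ z, 0 ≤ ρ z) ∧ ∫ z, ρ z = 1 ∧ tsupport ρ = Metric.closedBall c s := by
  let B : ContDiffBump c := ⟨s / 2, s, by positivity, by linarith⟩
  exact ⟨B.normed volume, B.contDiff_normed, B.hasCompactSupport_normed,
    fun z => B.nonneg_normed z, B.integral_normed, B.tsupport_normed_eq⟩

lemma memLp_indicator_cutoff_val (hΩ : IsOpen Ω) (hb : Bornology.IsBounded Ω) {χ : Space n → ℝ}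
    (hχ : ContDiff ℝ 1 χ) (v : H1 Ω) :
    MemLp (Ω.indicator fun y => χ y • valH1 v y) 2 volume :=
  (memLp_indicator_iff_restrict hΩ.measurableSet).2 (memLp_cutoff_val hb hχ v)

lemma memLp_indicator_cutoff_grad (hΩ : IsOpen Ω) (hb : Bornology.IsBounded Ω) {χ : Space n → ℝ}
    (hχ : ContDiff ℝ 1 χ) (v : H1 Ω) :
    MemLp (Ω.indicator fun y => χ y • gradH1 v y + valH1 v y • gradR χ y) 2 volume :=
  (memLp_indicator_iff_restrict hΩ.measurableSet).2 (memLp_cutoff_grad hb hχ v)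

lemma stronglyMeasurable_indicator_cutoff_val (hΩ : IsOpen Ω) {χ : Space n → ℝ}
    (hχ : ContDiff ℝ 1 χ) (v : H1 Ω) :
    StronglyMeasurable (Ω.indicator fun y => χ y • valH1 v y) := by
  have h : StronglyMeasurable (valH1 v : Space n → ℂ) := Lp.stronglyMeasurable (valH1 v)
  exact (hχ.continuous.stronglyMeasurable.smul h).indicator hΩ.measurableSet

lemma stronglyMeasurable_indicator_cutoff_grad (hΩ : IsOpen Ω) {χ : Space n → ℝ}
    (hχ : ContDiff ℝ 1 χ) (v : H1 Ω) :
    StronglyMeasurable (Ω.indicator fun y => χ y • gradH1 v y + valH1 v y • gradR χ y) := by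
  have h : StronglyMeasurable (valH1 v : Space n → ℂ) := Lp.stronglyMeasurable (valH1 v)
  have h' : StronglyMeasurable (gradH1 v : Space n → EuclideanSpace ℂ (Fin n)) :=
    Lp.stronglyMeasurable (gradH1 v)
  have h1 : StronglyMeasurable fun y => χ y • gradH1 v y :=
    hχ.continuous.stronglyMeasurable.smul h'
  have h2 : StronglyMeasurable fun y => valH1 v y • gradR χ y :=
    h.smul (continuous_gradR hχ).stronglyMeasurable
  exact (h1.add h2).indicator hΩ.measurableSet
-- The zero extension of χv is averaged with a kernel centred at -t • e. At x ∈ Ω the average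
-- involves only points x + t • e + b with ‖b‖ ≤ κt, and those in the support of χ belong to Ω by
-- the cone property. So on Ω the gradient of the mollification is the mollification Φ of the
-- zero-extended gradient, although this may fail outside Ω.
lemma exists_contDiff_approx_cutoff (hΩ : IsOpen Ω) (hb : Bornology.IsBounded Ω) {x₀ e : Space n}
    {r κ T : ℝ} (he : ‖e‖ ≤ 1) (hκ : 0 < κ) (hκ1 : κ ≤ 1) (hT : 0 < T)
    (hcone : ∀ t : ℝ, 0 < t → t < T → ∀ x ∈ Ω, ∀ b : Space n, ‖b‖ ≤ κ * t →
        x + t • e + b ∈ Metric.ball x₀ r → x + t • e + b ∈ Ω)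
    {χ : Space n → ℝ} (hχ : ContDiff ℝ ((⊤ : ℕ∞) : WithTop ℕ∞) χ)
    (hχr : tsupport χ ⊆ Metric.ball x₀ r) (v : H1 Ω) {ε : ℝ≥0∞} (hε : 0 < ε) :
    ∃ (φ : Space n → ℂ) (Φ : Space n → EuclideanSpace ℂ (Fin n)),
      ContDiff ℝ ((⊤ : ℕ∞) : WithTop ℕ∞) φ ∧ (∀ x ∈ Ω, gradC φ x = Φ x) ∧
      eLpNorm (fun x => φ x - Ω.indicator (fun y => χ y • valH1 v y) x) 2 volume ≤ ε ∧
      eLpNorm (fun x => Φ x -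
        Ω.indicator (fun y => χ y • gradH1 v y + valH1 v y • gradR χ y) x) 2 volume ≤ ε := by
  have hχ1 : ContDiff ℝ 1 χ := hχ.of_le (by exact_mod_cast le_top)
  have hwL := memLp_indicator_cutoff_val hΩ hb hχ1 v
  have hGL := memLp_indicator_cutoff_grad hΩ hb hχ1 v
  have hwm := stronglyMeasurable_indicator_cutoff_val hΩ hχ1 v
  have hGm := stronglyMeasurable_indicator_cutoff_grad hΩ hχ1 v
  obtain ⟨δ₁, hδ₁, h1⟩ := exists_forall_eLpNorm_mollify_sub_le hwm hwL hε
  obtain ⟨δ₂, hδ₂, h2⟩ := exists_forall_eLpNorm_mollify_sub_le hGm hGL hε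
  -- The shifted kernel lives in ‖z‖ ≤ t + κt ≤ 2t, which has to be below both approximation radii.
  obtain ⟨t, ht0, ht1, ht2, htT⟩ : ∃ t : ℝ, 0 < t ∧ 2 * t < δ₁ ∧ 2 * t < δ₂ ∧ t < T := by
    refine ⟨min (min δ₁ δ₂) T / 4, by positivity, ?_, ?_, ?_⟩
    · linarith [min_le_left (min δ₁ δ₂) T, min_le_left δ₁ δ₂]
    · linarith [min_le_left (min δ₁ δ₂) T, min_le_right δ₁ δ₂]
    · linarith [min_le_right (min δ₁ δ₂) T]
  obtain ⟨ρ, hρ, hρs, hρ0, hρi, hρt⟩ := exists_kernel (-(t • e)) (mul_pos hκ ht0)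
  have hsupp : ∀ z, ρ z ≠ 0 → ‖z‖ ≤ 2 * t := by
    intro z hz
    have hz' : z ∈ Metric.closedBall (-(t • e)) (κ * t) := hρt ▸ subset_tsupport ρ hz
    rw [Metric.mem_closedBall, dist_eq_norm] at hz'
    calc ‖z‖ = ‖(z - -(t • e)) - t • e‖ := by congr 1; abel
      _ ≤ ‖z - -(t • e)‖ + ‖t • e‖ := norm_sub_le _ _
      _ ≤ κ * t + t * 1 := by
        refine add_le_add hz' ?_
        rw [norm_smul, Real.norm_of_nonneg ht0.le]
        gcongr
      _ ≤ 2 * t := by nlinarith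
  refine ⟨_, _, ?_, ?_, h1 ρ hρ.continuous hρs hρ0 hρi fun z hz => (hsupp z hz).trans_lt ht1,
    h2 ρ hρ.continuous hρs hρ0 hρi fun z hz => (hsupp z hz).trans_lt ht2⟩
  · exact hρs.contDiff_convolution_left (ContinuousLinearMap.lsmul ℝ ℝ) hρ
      (hwL.locallyIntegrable (by norm_num))
  · intro x hx
    refine gradC_mollify hΩ hb hχ hρ hρs v fun y hy hxy => ?_
    rw [hρt, Metric.mem_closedBall, dist_eq_norm] at hxy
    have e1 : x + t • e + (y - x - t • e) = y := by abel
    have := hcone t ht0 htT x hx (y - x - t • e) (by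
      rw [← norm_neg]
      refine le_trans (le_of_eq ?_) hxy
      congr 1; abel) (by rw [e1]; exact hχr hy)
    rwa [e1] at this

/-- A cutoff of `v` to a small ball is a limit of smooth functions. -/
lemma cutoffH1_mem_closure (hΩ : IsOpen Ω) (hb : Bornology.IsBounded Ω) {x₀ e : Space n}
    {r κ T : ℝ} (he : ‖e‖ ≤ 1) (hκ : 0 < κ) (hκ1 : κ ≤ 1) (hT : 0 < T)
    (hcone : ∀ t : ℝ, 0 < t → t < T → ∀ x ∈ Ω, ∀ b : Space n, ‖b‖ ≤ κ * t →
        x + t • e + b ∈ Metric.ball x₀ r → x + t • e + b ∈ Ω)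
    {χ : Space n → ℝ} (hχ : ContDiff ℝ ((⊤ : ℕ∞) : WithTop ℕ∞) χ)
    (hχr : tsupport χ ⊆ Metric.ball x₀ r) (v : H1 Ω) :
    cutoffH1 hb hχ v ∈ (smoothH1 Ω).topologicalClosure := by
  rw [← SetLike.mem_coe, Submodule.topologicalClosure_coe, Metric.mem_closure_iff]
  intro ε hε
  obtain ⟨φ, Φ, hφd, hgrad, h1, h2⟩ := exists_contDiff_approx_cutoff hΩ hb he hκ hκ1 hT hcone hχ
    hχr v (ENNReal.ofReal_pos.2 (by positivity : 0 < ε / 3))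
  have hφ1 : ContDiff ℝ 1 φ := hφd.of_le (by exact_mod_cast le_top)
  refine ⟨H1.ofContDiff hb hφ1, ⟨φ, hφd, valH1_ofContDiff hb hφ1⟩, ?_⟩
  rw [dist_comm, dist_eq_norm]
  refine (norm_H1_le _).trans_lt ?_
  have b1 : ‖valH1 (H1.ofContDiff hb hφ1 - cutoffH1 hb hχ v)‖ ≤ ε / 3 := by
    rw [Lp.norm_def]
    refine ENNReal.toReal_le_of_le_ofReal (by positivity) (le_trans ?_ h1)
    refine le_trans (le_of_eq ?_) (eLpNorm_mono_measure _ (Measure.restrict_le_self (s := Ω)))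
    refine eLpNorm_congr_ae ?_
    filter_upwards [Lp.coeFn_sub (valH1 (H1.ofContDiff hb hφ1)) (valH1 (cutoffH1 hb hχ v)),
      valH1_ofContDiff hb hφ1, valH1_cutoffH1 hb hχ v, ae_restrict_mem hΩ.measurableSet]
      with x hx1 hx2 hx3 hx4
    rw [valH1_sub, hx1, Pi.sub_apply, hx2, hx3, Set.indicator_of_mem hx4]
  have b2 : ‖gradH1 (H1.ofContDiff hb hφ1 - cutoffH1 hb hχ v)‖ ≤ ε / 3 := by
    rw [Lp.norm_def]
    refine ENNReal.toReal_le_of_le_ofReal (by positivity) (le_trans ?_ h2)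
    refine le_trans (le_of_eq ?_) (eLpNorm_mono_measure _ (Measure.restrict_le_self (s := Ω)))
    refine eLpNorm_congr_ae ?_
    filter_upwards [Lp.coeFn_sub (gradH1 (H1.ofContDiff hb hφ1)) (gradH1 (cutoffH1 hb hχ v)),
      gradH1_ofContDiff hb hφ1, gradH1_cutoffH1 hb hχ v, ae_restrict_mem hΩ.measurableSet]
      with x hx1 hx2 hx3 hx4
    rw [gradH1_sub, hx1, Pi.sub_apply, hx2, hx3, hgrad x hx4, Set.indicator_of_mem hx4]
  linarith

open scoped Manifold in
/-- Smooth functions are dense in `H¹(Ω)`. -/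
lemma smoothH1_topologicalClosure (hΩ : IsBoundedLipschitzDomain Ω) :
    (smoothH1 Ω).topologicalClosure = ⊤ := by
  rw [eq_top_iff]
  intro v _
  choose! r hr e he κ hκ hκ1 T hT hcone using fun x₀ (hx₀ : x₀ ∈ closure Ω) =>
    exists_local_cone hΩ hx₀
  obtain ⟨s, hs, hcov⟩ := hΩ.isBounded.isCompact_closure.elim_nhds_subcover
    (fun x => Metric.ball x (r x)) fun x hx => Metric.ball_mem_nhds x (hr x hx)
  obtain ⟨f, hf⟩ := SmoothPartitionOfUnity.exists_isSubordinate 𝓘(ℝ, Space n)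
    (isClosed_closure (s := Ω)) (fun i : s => Metric.ball (i : Space n) (r i))
    (fun _ => Metric.isOpen_ball) (by simpa [Set.iUnion_subtype] using hcov)
  have hfd : ∀ i, ContDiff ℝ ((⊤ : ℕ∞) : WithTop ℕ∞) (f i) := fun i => (f i).contMDiff.contDiff
  -- The partition of unity sums to 1 on Ω, so v is a finite sum of pieces, each supported where a
  -- single cone direction works.
  have hsum : v = ∑ i, cutoffH1 hΩ.isBounded (hfd i) v := by
    refine H1.ext_val hΩ.isOpen ?_
    have hval : valH1 (∑ i, cutoffH1 hΩ.isBounded (hfd i) v) =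
        ∑ i, valH1 (cutoffH1 hΩ.isBounded (hfd i) v) :=
      map_sum (⟨⟨valH1, fun _ _ => rfl⟩, fun _ _ => rfl⟩ : H1 Ω →ₗ[ℂ] Lp ℂ 2 (vol Ω)) _ _
    rw [hval]
    refine Filter.EventuallyEq.trans ?_ (Lp.coeFn_finsetSum _ _).symm
    filter_upwards [ae_all_iff.2 fun i => valH1_cutoffH1 hΩ.isBounded (hfd i) v,
      ae_restrict_mem hΩ.isOpen.measurableSet] with x hx hxΩ
    rw [Finset.sum_apply]
    simp_rw [hx]
    rw [← Finset.sum_smul, ← finsum_eq_sum_of_fintype, f.sum_eq_one (subset_closure hxΩ), one_smul]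
  rw [hsum]
  refine Submodule.sum_mem _ fun i _ => ?_
  have hi := hs i i.2
  exact cutoffH1_mem_closure hΩ.isOpen hΩ.isBounded (he _ hi) (hκ _ hi) (hκ1 _ hi) (hT _ hi)
    (hcone _ hi) (hfd i) (hf i) v

end Density

/-! ### The trace operator on H¹(Ω) -/

section Trace

variable {n : ℕ} {Ω : Set (Space n)}

/-- This is Cauchy–Schwarz. Equality can fail because the derivative acts on real vectors only,
while its coefficients are complex. -/
lemma norm_fderiv_le_norm_gradC (φ : Space n → ℂ) (x : Space n) :
    ‖fderiv ℝ φ x‖ ≤ ‖gradC φ x‖ := by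
  refine ContinuousLinearMap.opNorm_le_bound _ (norm_nonneg _) fun y => ?_
  have h1 : fderiv ℝ φ x y = ∑ i, (y i : ℂ) * gradC φ x i := by
    conv_lhs => rw [← (EuclideanSpace.basisFun (Fin n) ℝ).sum_repr y]
    simp [map_sum]
  rw [h1]
  calc ‖∑ i, (y i : ℂ) * gradC φ x i‖ ≤ ∑ i, ‖y i‖ * ‖gradC φ x i‖ :=
        (norm_sum_le _ _).trans (le_of_eq (by simp))
    _ ≤ √(∑ i, ‖y i‖ ^ 2) * √(∑ i, ‖gradC φ x i‖ ^ 2) := Real.sum_mul_le_sqrt_mul_sqrt _ _ _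
    _ = ‖gradC φ x‖ * ‖y‖ := by rw [EuclideanSpace.norm_eq, EuclideanSpace.norm_eq, mul_comm]

lemma ofReal_norm_sq_eq_lintegral {F : Type*} [NormedAddCommGroup F] {μ : Measure (Space n)}
    (f : Lp F 2 μ) : ENNReal.ofReal (‖f‖ ^ 2) = ∫⁻ x, ‖f x‖ₑ ^ 2 ∂μ := by
  have := eLpNorm_nnreal_pow_eq_lintegral (f := f) (μ := μ) (p := 2) (by norm_num)
  rw [ENNReal.ofReal_pow (norm_nonneg _), Lp.norm_def, ENNReal.ofReal_toReal (Lp.eLpNorm_ne_top f)]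
  simpa using this

/-- The trace inequality in terms of the norms of `H¹(Ω)` and `L²(∂Ω)`. -/
lemma exists_norm_trace_le_of_smooth (hΩ : IsBoundedLipschitzDomain Ω) :
    ∃ C : ℝ, 0 ≤ C ∧ ∀ (v : H1 Ω) (g : Lp ℂ 2 (surf Ω)) (φ : Space n → ℂ),
      ContDiff ℝ ((⊤ : ℕ∞) : WithTop ℕ∞) φ → valH1 v =ᵐ[vol Ω] φ → g =ᵐ[surf Ω] φ →
      ‖g‖ ≤ C * ‖v‖ := by
  obtain ⟨C, hC, h⟩ := exists_trace_inequality hΩ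
  refine ⟨√C.toReal, by positivity, fun v g φ hφ hv hg => ?_⟩
  have hφ1 : ContDiff ℝ 1 φ := hφ.of_le (by exact_mod_cast le_top)
  have hgrad : gradH1 v =ᵐ[vol Ω] gradC φ := by
    have : v = H1.ofContDiff hΩ.isBounded hφ1 :=
      H1.ext_val hΩ.isOpen (hv.trans (valH1_ofContDiff hΩ.isBounded hφ1).symm)
    rw [this]
    exact gradH1_ofContDiff hΩ.isBounded hφ1
  have h1 : ENNReal.ofReal (‖g‖ ^ 2) ≤ ENNReal.ofReal (C.toReal * ‖v‖ ^ 2) := by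
    rw [ENNReal.ofReal_mul ENNReal.toReal_nonneg, ENNReal.ofReal_toReal hC, norm_sq_H1,
      ENNReal.ofReal_add (by positivity) (by positivity), ofReal_norm_sq_eq_lintegral,
      ofReal_norm_sq_eq_lintegral, ofReal_norm_sq_eq_lintegral]
    have e1 : ∫⁻ x, ‖g x‖ₑ ^ 2 ∂(surf Ω) = ∫⁻ x, ‖φ x‖ₑ ^ 2 ∂(surf Ω) :=
      lintegral_congr_ae (by filter_upwards [hg] with x hx; rw [hx])
    rw [e1]
    refine (h φ hφ1).trans (mul_le_mul_right ?_ _)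
    rw [← lintegral_add_left' ((Lp.aestronglyMeasurable (valH1 v)).enorm.pow_const 2)]
    refine lintegral_mono_ae ?_
    filter_upwards [hv, hgrad] with x hx1 hx2
    rw [hx1, hx2]
    gcongr
    rw [← ofReal_norm, ← ofReal_norm]
    exact ENNReal.ofReal_le_ofReal (norm_fderiv_le_norm_gradC φ x)
  rw [ENNReal.ofReal_le_ofReal_iff (by positivity)] at h1
  rw [← Real.sqrt_sq (norm_nonneg g), ← Real.sqrt_sq (norm_nonneg v), ← Real.sqrt_mul (by positivity)]
  exact Real.sqrt_le_sqrt h1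

/-- The pairs `(φ|_Ω, φ|_∂Ω)` with `φ` smooth. -/
def smoothTrace (Ω : Set (Space n)) : Submodule ℂ (H1 Ω × Lp ℂ 2 (surf Ω)) where
  carrier := {q : H1 Ω × Lp ℂ 2 (surf Ω) | ∃ φ : Space n → ℂ,
    ContDiff ℝ ((⊤ : ℕ∞) : WithTop ℕ∞) φ ∧ valH1 q.1 =ᵐ[vol Ω] φ ∧ q.2 =ᵐ[surf Ω] φ}
  zero_mem' := ⟨fun _ => 0, contDiff_const, Lp.coeFn_zero ℂ 2 (vol Ω), Lp.coeFn_zero ℂ 2 (surf Ω)⟩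
  add_mem' := by
    rintro v w ⟨φ, hφ, h, h1⟩ ⟨ψ, hψ, h', h1'⟩
    exact ⟨_, hφ.add hψ, (Lp.coeFn_add _ _).trans (h.add h'), (Lp.coeFn_add _ _).trans (h1.add h1')⟩
  smul_mem' := by
    rintro c v ⟨φ, hφ, h, h1⟩
    refine ⟨fun x => c • φ x, hφ.const_smul c, (Lp.coeFn_smul c (valH1 v.1)).trans ?_,
      (Lp.coeFn_smul c v.2).trans ?_⟩
    · filter_upwards [h] with x hx
      simp [hx]
    · filter_upwards [h1] with x hx
      simp [hx]

/-- Being a trace is thus a closed linear relation. -/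
lemma isTrace_iff {v : H1 Ω} {g : Lp ℂ 2 (surf Ω)} :
    IsTrace Ω v g ↔ (v, g) ∈ (smoothTrace Ω).topologicalClosure := Iff.rfl

/-- The trace inequality is a closed condition on pairs, so it passes from smooth pairs to their
closure. -/
lemma exists_norm_le_of_isTrace (hΩ : IsBoundedLipschitzDomain Ω) :
    ∃ C : ℝ, 0 ≤ C ∧ ∀ (v : H1 Ω) (g : Lp ℂ 2 (surf Ω)), IsTrace Ω v g → ‖g‖ ≤ C * ‖v‖ := by
  obtain ⟨C, hC, h⟩ := exists_norm_trace_le_of_smooth hΩ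
  refine ⟨C, hC, fun v g hvg => ?_⟩
  have hcl : IsClosed {q : H1 Ω × Lp ℂ 2 (surf Ω) | ‖q.2‖ ≤ C * ‖q.1‖} :=
    isClosed_le continuous_snd.norm (continuous_const.mul continuous_fst.norm)
  have hsub : {q : H1 Ω × Lp ℂ 2 (surf Ω) | ∃ φ : Space n → ℂ,
      ContDiff ℝ ((⊤ : ℕ∞) : WithTop ℕ∞) φ ∧ valH1 q.1 =ᵐ[vol Ω] φ ∧ q.2 =ᵐ[surf Ω] φ} ⊆
      {q | ‖q.2‖ ≤ C * ‖q.1‖} := fun q hq => by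
    obtain ⟨φ, hφ, hw, hk⟩ := hq
    exact h q.1 q.2 φ hφ hw hk
  have hmem : (v, g) ∈ {q : H1 Ω × Lp ℂ 2 (surf Ω) | ‖q.2‖ ≤ C * ‖q.1‖} :=
    closure_minimal hsub hcl hvg
  exact hmem

/-- By linearity the difference is a trace of 0, which the norm bound forces to vanish. -/
lemma isTrace_unique (hΩ : IsBoundedLipschitzDomain Ω) {v : H1 Ω} {g g' : Lp ℂ 2 (surf Ω)}
    (h : IsTrace Ω v g) (h' : IsTrace Ω v g') : g = g' := by
  obtain ⟨C, -, hC⟩ := exists_norm_le_of_isTrace hΩ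
  have h1 : IsTrace Ω 0 (g - g') := by
    have := Submodule.sub_mem _ (isTrace_iff.1 h) (isTrace_iff.1 h')
    simpa [isTrace_iff] using this
  have h2 := hC _ _ h1
  rw [norm_zero, mul_zero] at h2
  exact sub_eq_zero.1 (norm_le_zero_iff.1 h2)

lemma memLp_surf_of_continuous (hΩ : IsBoundedLipschitzDomain Ω) {f : Space n → ℂ}
    (hf : Continuous f) : MemLp f 2 (surf Ω) := by
  have : IsFiniteMeasure (surf Ω) := ⟨surf_univ_lt_top hΩ⟩
  obtain ⟨C, hC⟩ := hΩ.isBounded.isCompact_closure.exists_bound_of_continuousOn hf.continuousOn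
  exact MemLp.of_bound hf.aestronglyMeasurable C
    (ae_restrict_of_forall_mem isClosed_frontier.measurableSet
      fun x hx => hC x (frontier_subset_closure hx))

/-- The trace bound makes the projection of the closed relation to H¹(Ω) bounded below, so its range
is closed. The range contains the dense set of smooth functions, hence everything. -/
lemma exists_isTrace (hΩ : IsBoundedLipschitzDomain Ω) (v : H1 Ω) : ∃ g, IsTrace Ω v g := by
  obtain ⟨C, hC0, hC⟩ := exists_norm_le_of_isTrace hΩ
  let T := (smoothTrace Ω).topologicalClosure
  have hTc : IsClosed (T : Set (H1 Ω × Lp ℂ 2 (surf Ω))) :=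
    Submodule.isClosed_topologicalClosure _
  have : CompleteSpace T := hTc.completeSpace_coe
  let p : T →L[ℂ] H1 Ω := (ContinuousLinearMap.fst ℂ _ _).comp T.subtypeL
  have hanti : AntilipschitzWith (Real.toNNReal (max 1 C)) p := by
    refine ContinuousLinearMap.antilipschitz_of_bound p fun t => ?_
    rw [Real.coe_toNNReal _ (le_max_of_le_left zero_le_one)]
    have h1 := hC t.1.1 t.1.2 t.2
    change max ‖t.1.1‖ ‖t.1.2‖ ≤ max 1 C * ‖t.1.1‖
    refine max_le ?_ (h1.trans ?_)
    · exact le_mul_of_one_le_left (norm_nonneg _) (le_max_left _ _)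
    · gcongr
      exact le_max_right _ _
  have hcl := hanti.isClosed_range p.uniformContinuous
  have hsub : (smoothH1 Ω : Set (H1 Ω)) ⊆ Set.range p := by
    rintro w ⟨φ, hφ, hw⟩
    have hm := memLp_surf_of_continuous hΩ hφ.continuous
    exact ⟨⟨(w, hm.toLp φ), Submodule.le_topologicalClosure _ ⟨φ, hφ, hw, hm.coeFn_toLp⟩⟩, rfl⟩
  have hv : v ∈ Set.range p := by
    refine closure_minimal hsub hcl ?_
    rw [← Submodule.topologicalClosure_coe, smoothH1_topologicalClosure hΩ]
    trivial
  obtain ⟨t, ht⟩ := hv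
  refine ⟨t.1.2, ?_⟩
  rw [isTrace_iff, ← ht]
  exact t.2

lemma isTrace_trace (hΩ : IsBoundedLipschitzDomain Ω) (v : H1 Ω) : IsTrace Ω v (trace Ω v) := by
  have h := exists_isTrace hΩ v
  rw [trace, dif_pos h]
  exact h.choose_spec

lemma IsTrace.trace_eq (hΩ : IsBoundedLipschitzDomain Ω) {v : H1 Ω} {g : Lp ℂ 2 (surf Ω)}
    (h : IsTrace Ω v g) : trace Ω v = g :=
  isTrace_unique hΩ (isTrace_trace hΩ v) h

/-- The trace operator `H¹(Ω) → L²(∂Ω)` as a bounded linear map. -/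
lemma exists_traceL (hΩ : IsBoundedLipschitzDomain Ω) :
    ∃ T : H1 Ω →L[ℂ] Lp ℂ 2 (surf Ω), ∀ v, T v = trace Ω v := by
  obtain ⟨C, -, hC⟩ := exists_norm_le_of_isTrace hΩ
  refine ⟨LinearMap.mkContinuous ⟨⟨trace Ω, fun v w => ?_⟩, fun c v => ?_⟩ C
    fun v => hC v _ (isTrace_trace hΩ v), fun v => rfl⟩
  · exact IsTrace.trace_eq hΩ (Submodule.add_mem _ (isTrace_iff.1 (isTrace_trace hΩ v))
      (isTrace_iff.1 (isTrace_trace hΩ w)))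
  · exact IsTrace.trace_eq hΩ (Submodule.smul_mem _ c (isTrace_iff.1 (isTrace_trace hΩ v)))

lemma trace_const (hΩ : IsBoundedLipschitzDomain Ω) {v : H1 Ω} {c : ℂ}
    (h : ∀ᵐ x ∂(vol Ω), valH1 v x = c) : ∀ᵐ x ∂(surf Ω), trace Ω v x = c := by
  have hm := memLp_surf_of_continuous hΩ (continuous_const (y := c))
  have ht : IsTrace Ω v (hm.toLp _) :=
    subset_closure ⟨fun _ => c, contDiff_const, h, hm.coeFn_toLp⟩
  rw [ht.trace_eq hΩ]
  exact hm.coeFn_toLp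

/-- Conjugation is continuous and preserves smooth pairs, hence also their closure. -/
lemma trace_conj (hΩ : IsBoundedLipschitzDomain Ω) (v : H1 Ω) :
    ∀ᵐ x ∂(surf Ω), trace Ω (conjH1 v) x = starRingEnd ℂ (trace Ω v x) := by
  let L := (Complex.conjCLE : ℂ →L[ℝ] ℂ).compLpL 2 (surf Ω)
  have hcont : Continuous fun q : H1 Ω × Lp ℂ 2 (surf Ω) => (conjH1 q.1, L q.2) :=
    (continuous_conjH1.comp continuous_fst).prodMk (L.continuous.comp continuous_snd)
  have ht : IsTrace Ω (conjH1 v) (L (trace Ω v)) := by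
    refine map_mem_closure (f := fun q : H1 Ω × Lp ℂ 2 (surf Ω) => (conjH1 q.1, L q.2)) hcont
      (isTrace_trace hΩ v) ?_
    rintro ⟨w, g⟩ ⟨φ, hφ, hw, hg⟩
    refine ⟨fun x => starRingEnd ℂ (φ x), Complex.conjCLE.contDiff.comp hφ, ?_, ?_⟩
    · filter_upwards [valH1_conjH1 w, hw] with x h1 h2
      rw [h1, h2]
    · filter_upwards [(Complex.conjCLE : ℂ →L[ℝ] ℂ).coeFn_compLpL g, hg] with x h1 h2
      rw [h1, h2]
      rfl
  rw [ht.trace_eq hΩ]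
  exact (Complex.conjCLE : ℂ →L[ℝ] ℂ).coeFn_compLpL _

end Trace

/-! ### Coercive operators and the Hilbert space model of a quotient -/

section CoerciveOperators

variable {K : Type*} [NormedAddCommGroup K] [InnerProductSpace ℂ K]

/-- Coercivity of a bounded operator with constant `c`. -/
def CoerciveWith (c : ℝ) (A : K →L[ℂ] K) : Prop :=
  ∀ k, c * ‖k‖ ^ 2 ≤ (inner ℂ k (A k)).re

lemma CoerciveWith.mul_norm_le {c : ℝ} {A : K →L[ℂ] K} (h : CoerciveWith c A) (k : K) :
    c * ‖k‖ ≤ ‖A k‖ := by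
  rcases eq_or_ne k 0 with rfl | hk
  · simp
  have h1 : c * ‖k‖ ^ 2 ≤ ‖k‖ * ‖A k‖ :=
    (h k).trans ((Complex.re_le_norm _).trans (norm_inner_le_norm _ _))
  have h2 : 0 < ‖k‖ := norm_pos_iff.2 hk
  nlinarith

lemma CoerciveWith.norm_le {c : ℝ} (hc : 0 < c) {A : K →L[ℂ] K} (h : CoerciveWith c A) (k : K) :
    ‖k‖ ≤ c⁻¹ * ‖A k‖ := by
  rw [inv_mul_eq_div, le_div_iff₀ hc, mul_comm]
  exact h.mul_norm_le k

/-- The Lax–Milgram theorem. -/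
lemma CoerciveWith.isUnit [CompleteSpace K] {c : ℝ} (hc : 0 < c) {A : K →L[ℂ] K}
    (h : CoerciveWith c A) : IsUnit A := by
  refine ContinuousLinearMap.isUnit_of_forall_le_norm_inner_map A (c := ⟨c, hc.le⟩) hc fun k => ?_
  rw [← inner_conj_symm, RCLike.norm_conj, mul_comm]
  exact (h k).trans (Complex.re_le_norm _)

lemma CoerciveWith.add {c : ℝ} {A H : K →L[ℂ] K} (h : CoerciveWith c A) (hH : ‖H‖ ≤ c / 2) :
    CoerciveWith (c / 2) (A + H) := by
  intro k
  have h1 : ‖inner ℂ k (H k)‖ ≤ c / 2 * ‖k‖ ^ 2 := by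
    calc _ ≤ ‖k‖ * ‖H k‖ := norm_inner_le_norm _ _
      _ ≤ ‖k‖ * (c / 2 * ‖k‖) := by gcongr; exact H.le_of_opNorm_le hH k
      _ = _ := by ring
  have h2 := (abs_le.1 ((Complex.abs_re_le_norm _).trans h1)).1
  have h3 := h k
  rw [add_apply, inner_add_right, Complex.add_re]
  linarith

/-- The remainder in the first-order expansion of the solution of `A k = f`. -/
lemma CoerciveWith.norm_remainder_le {c : ℝ} (hc : 0 < c) {A H : K →L[ℂ] K}
    (h : CoerciveWith c A) (h' : CoerciveWith (c / 2) (A + H)) {f g k k' d : K} (hk : A k = f)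
    (hk' : (A + H) k' = f + g) (hd : A d = g - H k) :
    ‖k' - k - d‖ ≤ 2 * c⁻¹ ^ 2 * (‖H‖ * (‖g‖ + ‖H‖ * ‖k‖)) := by
  -- Here (A + H)(k + d) = f + H k + (g - H k) + H d = f + g + H d. As d is already of first order,
  -- H d is of second order.
  have h1 : (A + H) (k' - k - d) = -H d := by
    rw [map_sub, map_sub, hk']
    simp only [add_apply, hk, hd]
    abel
  have h2 := h'.norm_le (half_pos hc) (k' - k - d)
  rw [h1, norm_neg] at h2
  have h3 : ‖d‖ ≤ c⁻¹ * (‖g‖ + ‖H‖ * ‖k‖) := by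
    refine (h.norm_le hc d).trans ?_
    rw [hd]
    gcongr
    exact (norm_sub_le _ _).trans (by gcongr; exact H.le_opNorm k)
  calc _ ≤ (c / 2)⁻¹ * ‖H d‖ := h2
    _ ≤ (c / 2)⁻¹ * (‖H‖ * (c⁻¹ * (‖g‖ + ‖H‖ * ‖k‖))) := by
      gcongr
      exact (H.le_opNorm d).trans (by gcongr)
    _ = _ := by rw [inv_div]; ring

/-- The operators `G* m(a) G` on `K`, for a family of operators `m(a)` on `H` and `G : K → H`. -/
lemma exists_pullback_operator {H W : Type*} [NormedAddCommGroup H] [InnerProductSpace ℂ H]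
    [NormedAddCommGroup W] [NormedSpace ℂ W] [CompleteSpace K] [CompleteSpace H]
    (m : W →L[ℂ] H →L[ℂ] H) (G : K →L[ℂ] H) :
    ∃ A : W →L[ℂ] K →L[ℂ] K, ∀ a x y, inner ℂ y (A a x) = inner ℂ (G y) (m a (G x)) := by
  let A₁ : W →L[ℂ] K →L[ℂ] H := ((ContinuousLinearMap.compL ℂ K H H).flip G) ∘L m
  let A : W →L[ℂ] K →L[ℂ] K := (ContinuousLinearMap.compL ℂ K H K G.adjoint) ∘L A₁
  exact ⟨A, fun a x y => ContinuousLinearMap.adjoint_inner_right G _ _⟩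

/-- A form `⟪G y, m(a) G x⟫ + ⟪G' y, m'(b) G' x⟫` that vanishes on a closed subspace `N` is
represented by bounded operators on a Hilbert space `K` isometric to the quotient by `N`;
functionals and operators that vanish on `N` factor through `K` as well. -/
lemma exists_quotient_model {X : Type} {H H' W W' D : Type*} [NormedAddCommGroup X]
    [InnerProductSpace ℂ X] [CompleteSpace X] [NormedAddCommGroup H] [InnerProductSpace ℂ H]
    [CompleteSpace H] [NormedAddCommGroup H'] [InnerProductSpace ℂ H'] [CompleteSpace H']
    [NormedAddCommGroup W] [NormedSpace ℂ W] [NormedAddCommGroup W'] [NormedSpace ℂ W']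
    [NormedAddCommGroup D] [NormedSpace ℂ D]
    (N : Submodule ℂ X) [N.HasOrthogonalProjection]
    (m : W →L[ℂ] H →L[ℂ] H) (m' : W' →L[ℂ] H' →L[ℂ] H') (G : X →L[ℂ] H) (G' : X →L[ℂ] H')
    (hleft : ∀ a b, ∀ x ∈ N, ∀ y,
      inner ℂ (G y) (m a (G x)) + inner ℂ (G' y) (m' b (G' x)) = 0)
    (hright : ∀ a b x, ∀ y ∈ N,
      inner ℂ (G y) (m a (G x)) + inner ℂ (G' y) (m' b (G' x)) = 0)
    (g : D →L[ℂ] X) (hg : ∀ I, ∀ z ∈ N, inner ℂ z (g I) = 0)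
    (r : X →L[ℂ] D) (hr : ∀ z ∈ N, r z = 0) :
    ∃ (K : Type) (_ : NormedAddCommGroup K) (_ : InnerProductSpace ℂ K) (_ : CompleteSpace K)
      (π : X → K) (A : (W × W') →L[ℂ] K →L[ℂ] K) (l : D →L[ℂ] K) (e : K →L[ℂ] D),
      Function.Surjective π ∧ (∀ x x', π x = π x' ↔ x - x' ∈ N) ∧
      (∀ x, ‖(Submodule.Quotient.mk x : X ⧸ N)‖ = ‖π x‖) ∧
      (∀ a b x y, inner ℂ (G y) (m a (G x)) + inner ℂ (G' y) (m' b (G' x)) =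
        inner ℂ (π y) (A (a, b) (π x))) ∧
      (∀ I y, inner ℂ y (g I) = inner ℂ (π y) (l I)) ∧ ∀ x, r x = e (π x) := by
  -- K is the orthogonal complement of N. It is isometric to the quotient, with the orthogonal
  -- projection as quotient map.
  let P : X →L[ℂ] Nᗮ := Nᗮ.orthogonalProjectionOnto
  have hPc : ∀ x, x - (P x : X) ∈ N := fun x => by
    have h := Submodule.sub_starProjection_mem_orthogonal (K := Nᗮ) x
    rwa [Submodule.orthogonal_orthogonal] at h
  have hP0 : ∀ x ∈ N, P x = 0 := fun x hx =>
    Submodule.orthogonalProjectionOnto_eq_zero_iff.2 (Submodule.le_orthogonal_orthogonal _ hx)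
  have hPk : ∀ k : Nᗮ, P k = k := Submodule.orthogonalProjectionOnto_mem_subspace_eq_self
  obtain ⟨A₁, h₁⟩ := exists_pullback_operator m (G ∘L Nᗮ.subtypeL)
  obtain ⟨A₂, h₂⟩ := exists_pullback_operator m' (G' ∘L Nᗮ.subtypeL)
  refine ⟨Nᗮ, inferInstance, inferInstance, inferInstance, P,
    A₁ ∘L ContinuousLinearMap.fst ℂ _ _ + A₂ ∘L ContinuousLinearMap.snd ℂ _ _, P ∘L g,
    r ∘L Nᗮ.subtypeL, fun k => ⟨k, hPk k⟩, fun x x' => ?_, fun x => ?_, fun a b x y => ?_,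
    fun I y => ?_, fun x => ?_⟩
  · rw [← sub_eq_zero, ← map_sub]
    refine ⟨fun h => ?_, hP0 _⟩
    have := hPc (x - x')
    rwa [h, Submodule.coe_zero, sub_zero] at this
  · rw [(Submodule.Quotient.eq N).2 (hPc x), ← N.quotientEquivOrthogonal.norm_map,
      Submodule.quotientEquivOrthogonal_mk _ _ (P x).2]
  · have e1 := hleft a b _ (hPc x) y
    have e2 := hright a b (P x : X) _ (hPc y)
    simp only [map_sub, inner_sub_right, inner_sub_left] at e1 e2
    simp only [add_apply, inner_add_right, ContinuousLinearMap.comp_apply,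
      ContinuousLinearMap.coe_fst', ContinuousLinearMap.coe_snd']
    rw [h₁, h₂]
    simp only [ContinuousLinearMap.comp_apply, Submodule.subtypeL_apply]
    linear_combination e1 + e2
  · have h3 : g I ∈ Nᗮ := (Submodule.mem_orthogonal _ _).2 (hg I)
    have h4 : P (g I) = ⟨g I, h3⟩ := hPk ⟨g I, h3⟩
    have h5 := hg I _ (hPc y)
    rw [inner_sub_left, sub_eq_zero] at h5
    rw [h5, ContinuousLinearMap.comp_apply, h4]
    rfl
  · have := hr _ (hPc x)
    rw [map_sub, sub_eq_zero] at this
    exact this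

end CoerciveOperators

/-! ### The forms as bounded operators on the Hilbert space model -/

section FormOperator

variable {n M : ℕ} {Ω : Set (Space n)} {E : Fin M → Set (Space n)}

/-- The gradient of the first component, as a bounded operator. -/
def gradL (Ω : Set (Space n)) (M : ℕ) :
    PreH Ω M →L[ℂ] Lp (EuclideanSpace ℂ (Fin n)) 2 (vol Ω) :=
  (WithLp.sndL 2 ℂ _ _) ∘L (H1 Ω).subtypeL ∘L (WithLp.fstL 2 ℂ _ _)

lemma gradL_apply (x : PreH Ω M) : gradL Ω M x = gradH1 x.fst := rfl

lemma AreExtendedElectrodes.measurableSet (hE : AreExtendedElectrodes Ω E) (m : Fin M) :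
    MeasurableSet (E m) := by
  obtain ⟨O, hO, h⟩ := hE.relOpen m
  rw [h]
  exact hO.measurableSet.inter isClosed_frontier.measurableSet

/-- Finiteness of the surface measure puts the electrode indicators in L²(∂Ω); the rest is
boundedness of the trace. -/
lemma exists_jumpL (hΩ : IsBoundedLipschitzDomain Ω) (hE : AreExtendedElectrodes Ω E) :
    ∃ L : PreH Ω M →L[ℂ] Lp ℂ 2 (surf Ω), ∀ x, L x =ᵐ[surf Ω] jump E x := by
  obtain ⟨T, hT⟩ := exists_traceL hΩ
  have : IsFiniteMeasure (surf Ω) := ⟨surf_univ_lt_top hΩ⟩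
  let e : EuclideanSpace ℂ (Fin M) →L[ℂ] Lp ℂ 2 (surf Ω) :=
    ∑ m, (EuclideanSpace.proj m : EuclideanSpace ℂ (Fin M) →L[ℂ] ℂ).smulRight
      (indicatorConstLp 2 (hE.measurableSet m) (measure_ne_top (surf Ω) _) (1 : ℂ))
  have he : ∀ V, e V =ᵐ[surf Ω] electrodeFn E V := by
    intro V
    have h1 : e V = ∑ m, V m •
        indicatorConstLp 2 (hE.measurableSet m) (measure_ne_top (surf Ω) _) (1 : ℂ) := by
      simp [e]
    rw [h1]
    refine (Lp.coeFn_finsetSum _ _).trans ?_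
    have h2 : ∀ m, ∀ᵐ y ∂(surf Ω), (V m • indicatorConstLp 2 (hE.measurableSet m)
        (measure_ne_top (surf Ω) _) (1 : ℂ) : Lp ℂ 2 (surf Ω)) y =
        (E m).indicator (fun _ => V m) y := by
      intro m
      filter_upwards [Lp.coeFn_smul (V m) (indicatorConstLp 2 (hE.measurableSet m)
        (measure_ne_top (surf Ω) _) (1 : ℂ)), indicatorConstLp_coeFn (p := 2)
        (hs := hE.measurableSet m) (hμs := measure_ne_top (surf Ω) _) (c := (1 : ℂ))] with y h3 h4
      rw [h3, Pi.smul_apply, h4]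
      by_cases hy : y ∈ E m <;> simp [hy]
    filter_upwards [ae_all_iff.2 h2] with y hy
    rw [Finset.sum_apply, electrodeFn]
    exact Finset.sum_congr rfl fun m _ => hy m
  let L : PreH Ω M →L[ℂ] Lp ℂ 2 (surf Ω) :=
    e ∘L WithLp.sndL 2 ℂ (H1 Ω) (EuclideanSpace ℂ (Fin M)) -
      T ∘L WithLp.fstL 2 ℂ (H1 Ω) (EuclideanSpace ℂ (Fin M))
  refine ⟨L, fun x => ?_⟩
  have h1 : L x = e x.snd - trace Ω x.fst := by
    rw [← hT]
    rfl
  rw [h1]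
  filter_upwards [Lp.coeFn_sub (e x.snd) (trace Ω x.fst), he x.snd] with y h2 h3
  rw [h2, Pi.sub_apply, h3]
  rfl

/-- Multiplication by an `L^∞` function on `L²`. -/
def mulL {α : Type*} [MeasurableSpace α] (μ : Measure α) (F : Type*) [NormedAddCommGroup F]
    [NormedSpace ℂ F] : Lp ℂ ⊤ μ →L[ℂ] Lp F 2 μ →L[ℂ] Lp F 2 μ :=
  (ContinuousLinearMap.lsmul ℂ ℂ : ℂ →L[ℂ] F →L[ℂ] F).holderL μ ⊤ 2 2

lemma coeFn_mulL {α : Type*} [MeasurableSpace α] {μ : Measure α} {F : Type*}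
    [NormedAddCommGroup F] [NormedSpace ℂ F] (a : Lp ℂ ⊤ μ) (f : Lp F 2 μ) :
    mulL μ F a f =ᵐ[μ] fun x => a x • f x :=
  ContinuousLinearMap.coeFn_holder (r := 2) _ a f

lemma sesq_eq_inner {L : PreH Ω M →L[ℂ] Lp ℂ 2 (surf Ω)} (hL : ∀ x, L x =ᵐ[surf Ω] jump E x)
    (σ : LinfDom Ω) (ζ : LinfE Ω E) (x y : PreH Ω M) :
    sesq E σ ζ x y =
      inner ℂ (gradL Ω M y) (mulL (vol Ω) _ σ (gradL Ω M x)) +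
        inner ℂ (L y) (mulL (surf Ω) _ ζ.1 (L x)) := by
  rw [sesq, L2.inner_def, L2.inner_def]
  congr 1
  · refine integral_congr_ae ?_
    filter_upwards [coeFn_mulL σ (gradL Ω M x)] with p hp
    rw [hp, PiLp.inner_apply, Finset.mul_sum]
    refine Finset.sum_congr rfl fun i _ => ?_
    simp only [PiLp.smul_apply, smul_eq_mul, RCLike.inner_apply, gradL_apply]
    ring
  · refine integral_congr_ae ?_
    filter_upwards [coeFn_mulL ζ.1 (L x), hL x, hL y] with p hp h1 h2
    rw [hp, h1, h2]
    simp only [smul_eq_mul, RCLike.inner_apply]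
    ring

lemma gradH1_eq_zero_of_const (hΩ : IsBoundedLipschitzDomain Ω) {v : H1 Ω} {c : ℂ}
    (h : ∀ᵐ x ∂(vol Ω), valH1 v x = c) : gradH1 v = 0 := by
  have h1 : v = H1.ofContDiff hΩ.isBounded (contDiff_const (c := c)) :=
    H1.ext_val hΩ.isOpen (Filter.EventuallyEq.trans h (valH1_ofContDiff _ _).symm)
  rw [h1]
  refine Lp.ext ((gradH1_ofContDiff _ _).trans ?_)
  filter_upwards [Lp.coeFn_zero (EuclideanSpace ℂ (Fin n)) 2 (vol Ω)] with x hx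
  rw [hx]
  ext i
  simp

lemma gradL_eq_zero_of_mem_Consts (hΩ : IsBoundedLipschitzDomain Ω) {x : PreH Ω M}
    (hx : x ∈ Consts Ω M) : gradL Ω M x = 0 := by
  obtain ⟨c, hc, -⟩ := hx
  exact gradH1_eq_zero_of_const hΩ hc

/-- On E_m disjointness leaves a single term in the electrode function, and the jump is c - c. Off
the electrodes the jump is -c, but there ζ vanishes. -/
lemma mul_jump_eq_zero_of_mem_Consts (hΩ : IsBoundedLipschitzDomain Ω)
    (hE : AreExtendedElectrodes Ω E) (ζ : LinfE Ω E) {x : PreH Ω M} (hx : x ∈ Consts Ω M) :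
    ∀ᵐ y ∂(surf Ω), ζ.1 y = 0 ∨ jump E x y = 0 := by
  obtain ⟨c, hc, hc'⟩ := hx
  filter_upwards [ζ.2, trace_const hΩ hc] with y h1 h2
  by_cases hy : y ∈ ⋃ m, E m
  · right
    obtain ⟨m, hm⟩ := Set.mem_iUnion.1 hy
    rw [jump, h2, electrodeFn, Finset.sum_eq_single m]
    · simp [hm, hc']
    · intro l _ hl
      exact Set.indicator_of_notMem (Set.disjoint_right.1 (hE.disjoint l m hl) hm) _
    · simp
  · exact Or.inl (h1 hy)

lemma sesq_eq_zero_of_mem_Consts_left (hΩ : IsBoundedLipschitzDomain Ω)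
    (hE : AreExtendedElectrodes Ω E) (σ : LinfDom Ω) (ζ : LinfE Ω E) {x : PreH Ω M}
    (hx : x ∈ Consts Ω M) (y : PreH Ω M) : sesq E σ ζ x y = 0 := by
  obtain ⟨L, hL⟩ := exists_jumpL hΩ hE
  rw [sesq_eq_inner hL, gradL_eq_zero_of_mem_Consts hΩ hx, map_zero, inner_zero_right, zero_add]
  have h0 : mulL (surf Ω) ℂ ζ.1 (L x) = 0 := by
    refine Lp.ext ?_
    filter_upwards [coeFn_mulL ζ.1 (L x), hL x, mul_jump_eq_zero_of_mem_Consts hΩ hE ζ hx,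
      Lp.coeFn_zero ℂ 2 (surf Ω)] with p h1 h2 h3 h4
    rw [h1, h2, h4]
    rcases h3 with h | h <;> simp [h]
  rw [h0, inner_zero_right]

lemma sesq_eq_zero_of_mem_Consts_right (hΩ : IsBoundedLipschitzDomain Ω)
    (hE : AreExtendedElectrodes Ω E) (σ : LinfDom Ω) (ζ : LinfE Ω E) (x : PreH Ω M)
    {y : PreH Ω M} (hy : y ∈ Consts Ω M) : sesq E σ ζ x y = 0 := by
  have h1 : gradH1 y.fst = 0 := gradL_eq_zero_of_mem_Consts hΩ hy
  rw [sesq, integral_eq_zero_of_ae, integral_eq_zero_of_ae, add_zero]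
  · filter_upwards [mul_jump_eq_zero_of_mem_Consts hΩ hE ζ hy] with p h
    rcases h with h | h <;> simp [h]
  · rw [h1]
    filter_upwards [Lp.coeFn_zero (EuclideanSpace ℂ (Fin n)) 2 (vol Ω)] with p h
    simp only [h, Pi.zero_apply, PiLp.zero_apply, map_zero, mul_zero, Finset.sum_const_zero]

/-- The constant c can be read off any electrode entry, so one electrode is enough for injectivity.
Finite dimension supplies the orthogonal projection onto the constants. -/
lemma finiteDimensional_Consts (hΩ : IsBoundedLipschitzDomain Ω) (hM : 0 < M) :
    FiniteDimensional ℂ (Consts Ω M) := by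
  let f : Consts Ω M →ₗ[ℂ] EuclideanSpace ℂ (Fin M) :=
    ((WithLp.sndL 2 ℂ (H1 Ω) (EuclideanSpace ℂ (Fin M))) ∘L (Consts Ω M).subtypeL : _ →L[ℂ] _)
  refine FiniteDimensional.of_injective f ((injective_iff_map_eq_zero f).2 ?_)
  rintro ⟨x, hx⟩ hfx
  obtain ⟨c, hc, hc'⟩ := hx
  have hs : x.snd = 0 := hfx
  have hc0 : c = 0 := by rw [← hc' ⟨0, hM⟩, hs]; rfl
  have hf : x.fst = 0 := H1.ext_val hΩ.isOpen <| by
    filter_upwards [hc, Lp.coeFn_zero ℂ 2 (vol Ω)] with y h1 h2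
    rw [h1, hc0]
    exact h2.symm
  exact Subtype.ext ((WithLp.ofLp_injective 2) (Prod.ext hf hs))

/-- A Hilbert space model of `𝓗¹` in which the forms `B_{σ,ζ}` are bounded operators depending
linearly and continuously on `(σ, ζ)`. -/
structure HilbertModel (Ω : Set (Space n)) (E : Fin M → Set (Space n)) (K : Type)
    [NormedAddCommGroup K] [InnerProductSpace ℂ K] where
  /-- the quotient map -/
  proj : PreH Ω M → K
  /-- the operators representing the forms -/
  op : (LinfDom Ω × LinfE Ω E) →L[ℂ] K →L[ℂ] K
  /-- the right-hand sides -/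
  load : Diamond M →L[ℂ] K
  /-- the electrode potentials -/
  obs : K →L[ℂ] Diamond M
  proj_surjective : Function.Surjective proj
  proj_eq_iff : ∀ x x', proj x = proj x' ↔ QuotH.mk x = QuotH.mk x'
  norm_mk : ∀ x, ‖QuotH.mk x‖ = ‖proj x‖
  sesq_eq : ∀ σ ζ x y, sesq E σ ζ x y = inner ℂ (proj y) (op (σ, ζ) (proj x))
  load_eq : ∀ (I : Diamond M) (y : PreH Ω M),
    ∑ m, I.1 m * starRingEnd ℂ (y.snd m) = inner ℂ (proj y) (load I)
  electrodePart_eq : ∀ x, electrodePart Ω M (QuotH.mk x) = obs (proj x)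

lemma exists_hilbertModel (hΩ : IsBoundedLipschitzDomain Ω) (hE : AreExtendedElectrodes Ω E)
    (hM : 0 < M) :
    ∃ (K : Type) (_ : NormedAddCommGroup K) (_ : InnerProductSpace ℂ K) (_ : CompleteSpace K),
      Nonempty (HilbertModel Ω E K) := by
  obtain ⟨L, hL⟩ := exists_jumpL hΩ hE
  have := finiteDimensional_Consts (Ω := Ω) hΩ hM
  have hsesq := sesq_eq_inner hL
  let S : PreH Ω M →L[ℂ] EuclideanSpace ℂ (Fin M) := WithLp.sndL 2 ℂ (H1 Ω) _
  have hS : ∀ (I : Diamond M) (y : PreH Ω M),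
      inner ℂ y ((S.adjoint ∘L (Diamond M).subtypeL) I) =
        ∑ m, I.1 m * starRingEnd ℂ (y.snd m) := by
    intro I y
    refine (ContinuousLinearMap.adjoint_inner_right S _ _).trans ?_
    rw [PiLp.inner_apply]
    rfl
  obtain ⟨K, i1, i2, i3, π, A, l, e, h1, h2, h3, h4, h5, h6⟩ :=
    exists_quotient_model (Consts Ω M) (mulL (vol Ω) (EuclideanSpace ℂ (Fin n)))
      (mulL (surf Ω) ℂ ∘L (LinfE Ω E).subtypeL) (gradL Ω M) L
      (fun σ ζ x hx y => (hsesq σ ζ x y).symm.trans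
        (sesq_eq_zero_of_mem_Consts_left hΩ hE σ ζ hx y))
      (fun σ ζ x y hy => (hsesq σ ζ x y).symm.trans
        (sesq_eq_zero_of_mem_Consts_right hΩ hE σ ζ x hy))
      (S.adjoint ∘L (Diamond M).subtypeL)
      -- The load I · V̄ annihilates c𝟏 because I has zero sum, and subtracting the mean kills c𝟏
      -- below. Both therefore descend to the quotient.
      (fun I z hz => by
        obtain ⟨c, -, hc⟩ := hz
        rw [hS]
        simp_rw [hc]
        rw [← Finset.sum_mul, show ∑ m, I.1 m = 0 from I.2, zero_mul])
      ((LinearMap.toContinuousLinearMap (removeMean M)) ∘L S)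
      (fun z hz => by
        have h0 : QuotH.mk z = 0 := (Submodule.Quotient.mk_eq_zero _).2 hz
        have h := congrArg (electrodePart Ω M) h0
        rw [map_zero] at h
        exact h)
  refine ⟨K, i1, i2, i3, ⟨⟨π, A, l, e, h1, fun x x' => ?_, h3, fun σ ζ x y => ?_, fun I y => ?_, h6⟩⟩⟩
  · rw [h2]
    exact (Submodule.Quotient.eq _).symm
  · rw [hsesq]
    exact h4 σ ζ x y
  · rw [← hS, h5]

end FormOperator

/-! ### Conjugation and the symmetric bilinear form -/

section BilinearForm

variable {n M : ℕ} {Ω : Set (Space n)} {E : Fin M → Set (Space n)}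

/-- Complex conjugation on `H¹(Ω) ⊕ ℂ^M`. -/
def conjPre (y : PreH Ω M) : PreH Ω M := WithLp.toLp 2 (conjH1 y.fst, conjVec M y.snd)

lemma conjPre_snd_apply (y : PreH Ω M) (m : Fin M) :
    (conjPre y).snd m = starRingEnd ℂ (y.snd m) := rfl

lemma jump_conjPre (hΩ : IsBoundedLipschitzDomain Ω) (y : PreH Ω M) :
    ∀ᵐ p ∂(surf Ω), jump E (conjPre y) p = starRingEnd ℂ (jump E y p) := by
  filter_upwards [trace_conj hΩ y.fst] with p hp
  have h1 : trace Ω (conjPre y).fst p = starRingEnd ℂ (trace Ω y.fst p) := hp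
  rw [jump, jump, h1, map_sub]
  congr 1
  simp only [electrodeFn, map_sum, conjPre_snd_apply]
  refine Finset.sum_congr rfl fun m _ => ?_
  by_cases h : p ∈ E m <;> simp [h]

/-- Testing with conjugates converts the variational equations into statements about a symmetric
form, as reciprocity requires even for complex σ and ζ. -/
lemma bilin_eq_sesq_conjPre (hΩ : IsBoundedLipschitzDomain Ω) (σ : LinfDom Ω) (ζ : LinfE Ω E)
    (x y : PreH Ω M) : bilin E σ ζ x y = sesq E σ ζ x (conjPre y) := by
  rw [bilin, sesq]
  congr 1
  · refine integral_congr_ae ?_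
    filter_upwards [gradH1_conjH1 y.fst] with p hp
    have h1 : gradH1 (conjPre y).fst p = conjVec n (gradH1 y.fst p) := hp
    simp only [h1, conjVec_apply, Complex.conj_conj]
  · refine integral_congr_ae ?_
    filter_upwards [jump_conjPre (E := E) hΩ y] with p hp
    rw [hp, Complex.conj_conj]

lemma bilin_comm (σ : LinfDom Ω) (ζ : LinfE Ω E) (x y : PreH Ω M) :
    bilin E σ ζ x y = bilin E σ ζ y x := by
  rw [bilin, bilin]
  congr 1 <;> refine integral_congr_ae (Filter.Eventually.of_forall fun p => ?_)
  · exact congrArg _ (Finset.sum_congr rfl fun i _ => mul_comm _ _)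
  · exact congrArg _ (mul_comm _ _)

end BilinearForm

/-! ### Solvability, stability and first-order expansion in the model -/

lemma ae_norm_le_norm_Linf {α : Type*} [MeasurableSpace α] {μ : Measure α} (f : Lp ℂ ⊤ μ) :
    ∀ᵐ x ∂μ, ‖f x‖ ≤ ‖f‖ := by
  filter_upwards [enorm_ae_le_eLpNormEssSup f μ] with x hx
  rw [← eLpNorm_exponent_top, ← ofReal_norm] at hx
  rw [Lp.norm_def]
  exact (ENNReal.ofReal_le_iff_le_toReal (Lp.eLpNorm_ne_top f)).1 hx

namespace HilbertModel

variable {n M : ℕ} {Ω : Set (Space n)} {E : Fin M → Set (Space n)} {K : Type}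
  [NormedAddCommGroup K] [InnerProductSpace ℂ K] (H : HilbertModel Ω E K)

lemma isCoerciveAt_iff (σ : LinfDom Ω) (ζ : LinfE Ω E) :
    IsCoerciveAt E σ ζ ↔ ∃ c : ℝ, 0 < c ∧ CoerciveWith c (H.op (σ, ζ)) := by
  refine exists_congr fun c => and_congr_right fun _ => ⟨fun h k => ?_, fun h x => ?_⟩
  · obtain ⟨x, rfl⟩ := H.proj_surjective k
    rw [← H.norm_mk, ← H.sesq_eq]
    exact h x
  · rw [H.norm_mk, H.sesq_eq]
    exact h _

/-- Since `proj` is surjective, testing with every (v, V) determines a vector of K, and the choice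
of representative does not matter. -/
lemma solvesVar_mk_iff {σ : LinfDom Ω} {ζ : LinfE Ω E} {F : PreH Ω M → ℂ} {f : K}
    (hF : ∀ y, F y = inner ℂ (H.proj y) f) (x : PreH Ω M) :
    SolvesVar E σ ζ F (QuotH.mk x) ↔ H.op (σ, ζ) (H.proj x) = f := by
  refine ⟨fun h => ext_inner_left ℂ fun k => ?_, fun h x' hx' y => ?_⟩
  · obtain ⟨y, rfl⟩ := H.proj_surjective k
    rw [← H.sesq_eq, ← hF]
    exact h x rfl y
  · rw [H.sesq_eq, (H.proj_eq_iff x' x).2 hx', h, hF]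

lemma existsUnique_solvesVar [CompleteSpace K] {σ : LinfDom Ω} {ζ : LinfE Ω E} {c : ℝ}
    (hc : 0 < c) (h : CoerciveWith c (H.op (σ, ζ))) {F : PreH Ω M → ℂ} {f : K}
    (hF : ∀ y, F y = inner ℂ (H.proj y) f) : ∃! p, SolvesVar E σ ζ F p := by
  have hb := ContinuousLinearMap.isUnit_iff_bijective.1 (h.isUnit hc)
  obtain ⟨k, hk⟩ := hb.2 f
  obtain ⟨x, rfl⟩ := H.proj_surjective k
  refine ⟨QuotH.mk x, (H.solvesVar_mk_iff hF x).2 hk, fun p hp => ?_⟩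
  obtain ⟨x', rfl⟩ := Submodule.Quotient.mk_surjective _ p
  exact (H.proj_eq_iff _ _).1 (hb.1 (((H.solvesVar_mk_iff hF x').1 hp).trans hk.symm))

lemma solvesForward_mk_iff {σ : LinfDom Ω} {ζ : LinfE Ω E} {I : Diamond M} (x : PreH Ω M) :
    SolvesForward E σ ζ I (QuotH.mk x) ↔ H.op (σ, ζ) (H.proj x) = H.load I :=
  H.solvesVar_mk_iff (H.load_eq I) x

lemma aux_rhs_eq (x : PreH Ω M) (ω : LinfDom Ω) (η : LinfE Ω E) (J : Diamond M)
    (y : PreH Ω M) :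
    (∑ m, J.1 m * starRingEnd ℂ (y.snd m)) - sesq E ω η x y =
      inner ℂ (H.proj y) (H.load J - H.op (ω, η) (H.proj x)) := by
  rw [H.load_eq, H.sesq_eq, inner_sub_right]

lemma solvesAux_mk_iff {σ : LinfDom Ω} {ζ : LinfE Ω E} (x : PreH Ω M) (ω : LinfDom Ω)
    (η : LinfE Ω E) (J : Diamond M) (x' : PreH Ω M) :
    SolvesAux E σ ζ x ω η J (QuotH.mk x') ↔
      H.op (σ, ζ) (H.proj x') = H.load J - H.op (ω, η) (H.proj x) :=
  H.solvesVar_mk_iff (H.aux_rhs_eq x ω η J) x'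

/-- Uniqueness makes the choice in the definition of `potentialMap` immaterial. -/
lemma potentialMap_eq [CompleteSpace K] {σ : LinfDom Ω} {ζ : LinfE Ω E} {c : ℝ}
    (hc : 0 < c) (h : CoerciveWith c (H.op (σ, ζ))) {I : Diamond M} {k : K}
    (hk : H.op (σ, ζ) k = H.load I) : potentialMap E σ ζ I = H.obs k := by
  have hex : ∃! p, SolvesForward E σ ζ I p := H.existsUnique_solvesVar hc h (H.load_eq I)
  obtain ⟨x, rfl⟩ := H.proj_surjective k
  rw [potentialMap, dif_pos hex.exists, ← H.electrodePart_eq,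
    hex.unique hex.exists.choose_spec ((H.solvesForward_mk_iff x).2 hk)]

/-- Coercivity is stable under small perturbations. -/
lemma exists_stable {σ : LinfDom Ω} {ζ : LinfE Ω E} (hσ : σ ∈ admS Ω) {c : ℝ} (hc : 0 < c)
    (h : CoerciveWith c (H.op (σ, ζ))) :
    ∃ δ : ℝ, 0 < δ ∧ ∀ (ω : LinfDom Ω) (η : LinfE Ω E), ‖ω‖ ≤ δ → ‖η‖ ≤ δ →
      CoerciveWith (c / 2) (H.op (σ, ζ) + H.op (ω, η)) ∧ (σ + ω, ζ + η) ∈ coercivePairs Ω E := by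
  obtain ⟨s, hs, hσs⟩ := hσ
  have hA : 0 < ‖H.op‖ + 1 := by positivity
  -- The first bound keeps Re σ ≥ s/2. The second makes the perturbing operator at most c/2 in norm,
  -- the added 1 preventing division by zero.
  refine ⟨min (s / 2) (c / 2 / (‖H.op‖ + 1)), by positivity, fun ω η hω hη => ?_⟩
  have h1 : ‖H.op (ω, η)‖ ≤ c / 2 := by
    have h2 : ‖(ω, η)‖ ≤ c / 2 / (‖H.op‖ + 1) :=
      max_le (hω.trans (min_le_right _ _)) (hη.trans (min_le_right _ _))
    calc _ ≤ ‖H.op‖ * ‖(ω, η)‖ := H.op.le_opNorm _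
      _ ≤ (‖H.op‖ + 1) * (c / 2 / (‖H.op‖ + 1)) := by gcongr; linarith
      _ = c / 2 := by field_simp
  have h3 := h.add h1
  refine ⟨h3, ⟨s / 2, by positivity, ?_⟩, (H.isCoerciveAt_iff _ _).2 ⟨c / 2, by positivity, ?_⟩⟩
  · filter_upwards [hσs, ae_norm_le_norm_Linf ω, Lp.coeFn_add σ ω] with x hx1 hx2 hx3
    have h4 := (abs_le.1 ((Complex.abs_re_le_norm (ω x)).trans
      (hx2.trans (hω.trans (min_le_left _ _))))).1
    change s / 2 ≤ ((σ + ω : LinfDom Ω) x).re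
    rw [hx3, Pi.add_apply, Complex.add_re]
    linarith
  · change CoerciveWith (c / 2) (H.op (σ + ω, ζ + η))
    rw [← Prod.mk_add_mk, map_add]
    exact h3

lemma isOpen_coercivePairs (H : HilbertModel Ω E K) : IsOpen (coercivePairs Ω E) := by
  rw [Metric.isOpen_iff]
  rintro ⟨σ, ζ⟩ ⟨hσ, hc⟩
  obtain ⟨c, hc, h⟩ := (H.isCoerciveAt_iff σ ζ).1 hc
  obtain ⟨δ, hδ, hst⟩ := H.exists_stable hσ hc h
  refine ⟨δ, hδ, fun q hq => ?_⟩
  rw [Metric.mem_ball, dist_eq_norm] at hq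
  have := (hst (q.1 - σ) (q.2 - ζ) ((norm_fst_le (q - (σ, ζ))).trans hq.le)
    ((norm_snd_le (q - (σ, ζ))).trans hq.le)).2
  simpa using this

/-- The first-order expansion of the potential map. -/
lemma exists_quadratic_remainder [CompleteSpace K] {σ : LinfDom Ω} {ζ : LinfE Ω E}
    (hσ : σ ∈ admS Ω) {c : ℝ} (hc : 0 < c) (h : CoerciveWith c (H.op (σ, ζ))) (I : Diamond M) :
    ∃ U' : (LinfDom Ω × LinfE Ω E × Diamond M) →L[ℂ] Diamond M,
      (∃ C δ : ℝ, 0 < C ∧ 0 < δ ∧ ∀ (ω : LinfDom Ω) (η : LinfE Ω E) (J : Diamond M),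
        ‖ω‖ ≤ δ → ‖η‖ ≤ δ → (σ + ω, ζ + η) ∈ coercivePairs Ω E ∧
          ‖potentialMap E (σ + ω) (ζ + η) (I + J) - potentialMap E σ ζ I - U' (ω, η, J)‖
            ≤ C * ‖(ω, η, J)‖ ^ 2) ∧
      ∀ (k : K), H.op (σ, ζ) k = H.load I → ∀ ω η J d,
        H.op (σ, ζ) d = H.load J - H.op (ω, η) k → U' (ω, η, J) = H.obs d := by
  obtain ⟨u, hu⟩ := h.isUnit hc
  have hinj := (ContinuousLinearMap.isUnit_iff_bijective.1 (h.isUnit hc)).1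
  let R : K →L[ℂ] K := ((u⁻¹ : (K →L[ℂ] K)ˣ) : K →L[ℂ] K)
  have hR : ∀ f, H.op (σ, ζ) (R f) = f := fun f => by
    rw [← hu]
    exact DFunLike.congr_fun u.mul_inv f
  obtain ⟨k, hk⟩ : ∃ k, H.op (σ, ζ) k = H.load I := ⟨_, hR _⟩
  -- This is the right-hand side of the linearized equation; the derivative is `obs` applied to its
  -- solution.
  let D : (LinfDom Ω × LinfE Ω E × Diamond M) →L[ℂ] K :=
    H.load ∘L (ContinuousLinearMap.snd ℂ _ _ ∘L ContinuousLinearMap.snd ℂ _ _) -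
      (H.op.flip k) ∘L ((ContinuousLinearMap.fst ℂ _ _).prod
        (ContinuousLinearMap.fst ℂ _ _ ∘L ContinuousLinearMap.snd ℂ _ _))
  have hD : ∀ ω η J, D (ω, η, J) = H.load J - H.op (ω, η) k := fun _ _ _ => rfl
  obtain ⟨δ, hδ, hst⟩ := H.exists_stable hσ hc h
  -- The added 1 only makes the constant positive. No smallness of J is required, since the load
  -- enters the equation linearly.
  refine ⟨H.obs ∘L R ∘L D, ⟨‖H.obs‖ * (2 * c⁻¹ ^ 2 * (‖H.op‖ * (‖H.load‖ + ‖H.op‖ * ‖k‖))) + 1, δ,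
    by positivity, hδ, fun ω η J hω hη => ⟨(hst ω η hω hη).2, ?_⟩⟩, ?_⟩
  · obtain ⟨h', -⟩ := hst ω η hω hη
    have hop : H.op (σ + ω, ζ + η) = H.op (σ, ζ) + H.op (ω, η) := by
      rw [← Prod.mk_add_mk, map_add]
    obtain ⟨k', hk'⟩ := (ContinuousLinearMap.isUnit_iff_bijective.1
      (h'.isUnit (half_pos hc))).2 (H.load I + H.load J)
    have e1 : potentialMap E (σ + ω) (ζ + η) (I + J) = H.obs k' := by
      refine H.potentialMap_eq (half_pos hc) ?_ ?_
      · rw [hop]; exact h'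
      · rw [hop, map_add H.load]; exact hk'
    rw [e1, H.potentialMap_eq hc h hk, ContinuousLinearMap.comp_apply,
      ContinuousLinearMap.comp_apply, hD, ← map_sub, ← map_sub]
    have hrem := CoerciveWith.norm_remainder_le hc h h' hk hk' (hR (H.load J - H.op (ω, η) k))
    set N := ‖(ω, η, J)‖ with hN
    have hJ : ‖J‖ ≤ N := (norm_snd_le (η, J)).trans (norm_snd_le (ω, η, J))
    have hH : ‖H.op (ω, η)‖ ≤ ‖H.op‖ * N := by
      refine (H.op.le_opNorm _).trans ?_
      gcongr
      exact max_le (norm_fst_le (ω, η, J)) ((norm_fst_le (η, J)).trans (norm_snd_le (ω, η, J)))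
    have hl : ‖H.load J‖ ≤ ‖H.load‖ * N := (H.load.le_opNorm _).trans (by gcongr)
    calc _ ≤ ‖H.obs‖ * (2 * c⁻¹ ^ 2 *
          (‖H.op (ω, η)‖ * (‖H.load J‖ + ‖H.op (ω, η)‖ * ‖k‖))) :=
          (H.obs.le_opNorm _).trans (by gcongr)
      _ ≤ ‖H.obs‖ * (2 * c⁻¹ ^ 2 *
          ((‖H.op‖ * N) * ((‖H.load‖ * N) + (‖H.op‖ * N) * ‖k‖))) := by gcongr
      _ = ‖H.obs‖ * (2 * c⁻¹ ^ 2 * (‖H.op‖ * (‖H.load‖ + ‖H.op‖ * ‖k‖))) * N ^ 2 := by ring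
      _ ≤ _ := by gcongr; linarith
  · intro k₁ hk₁ ω η J d hd
    obtain rfl : k₁ = k := hinj (hk₁.trans hk.symm)
    have : R (D (ω, η, J)) = d := hinj (by rw [hR, hD, hd])
    rw [← this]
    rfl

end HilbertModel

/-- Differentiability from a quadratic bound on the remainder. -/
lemma hasFDerivAt_of_quadratic_remainder {F G : Type*} [NormedAddCommGroup F] [NormedSpace ℂ F]
    [NormedAddCommGroup G] [NormedSpace ℂ G] {f : F → G} {f' : F →L[ℂ] G} {x : F} {C δ : ℝ}
    (hδ : 0 < δ) (h : ∀ y, ‖y‖ ≤ δ → ‖f (x + y) - f x - f' y‖ ≤ C * ‖y‖ ^ 2) :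
    HasFDerivAt f f' x := by
  rw [hasFDerivAt_iff_isLittleO_nhds_zero]
  have h1 : (fun y => f (x + y) - f x - f' y) =O[𝓝 0] fun y : F => ‖y‖ ^ 2 := by
    refine Asymptotics.IsBigO.of_bound C ?_
    filter_upwards [Metric.closedBall_mem_nhds (0 : F) hδ] with y hy
    rw [norm_pow, norm_norm]
    exact h y (by simpa using hy)
  exact h1.trans_isLittleO (Asymptotics.isLittleO_norm_pow_id one_lt_two)

/-- This converts the square of the product norm into the maximum of squares in the remainder
estimate. -/
lemma max_sq_le {a b c : ℝ} :
    (max a (max b c)) ^ 2 ≤ max (a ^ 2) (max (b ^ 2) (c ^ 2)) := by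
  rcases max_choice a (max b c) with h | h <;> rw [h]
  · exact le_max_left _ _
  · rcases max_choice b c with h' | h' <;> rw [h']
    · exact (le_max_left _ _).trans (le_max_right _ _)
    · exact (le_max_right _ _).trans (le_max_right _ _)

end EIT

end

/-! ### The main theorem -/

theorem mainTheorem1 {n M : ℕ} (hn : n = 2 ∨ n = 3) (hM : 2 ≤ M)
    {Ω : Set (EIT.Space n)} (hΩ : EIT.IsBoundedLipschitzDomain Ω)
    {E : Fin M → Set (EIT.Space n)} (hE : EIT.AreExtendedElectrodes Ω E) :
    IsOpen (EIT.coercivePairs Ω E) ∧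
    EIT.admS Ω ×ˢ EIT.admZ' Ω E ⊆ EIT.coercivePairs Ω E ∧
    ∀ (σ : EIT.LinfDom Ω) (ζ : EIT.LinfE Ω E), (σ, ζ) ∈ EIT.coercivePairs Ω E →
      (∀ I : EIT.Diamond M,
        (∃! p : EIT.QuotH Ω M, EIT.SolvesForward E σ ζ I p) ∧
        ∀ p : EIT.QuotH Ω M, EIT.SolvesForward E σ ζ I p →
          EIT.potentialMap E σ ζ I = EIT.electrodePart Ω M p) ∧
      ∀ I : EIT.Diamond M,
        ∃ U' : (EIT.LinfDom Ω × EIT.LinfE Ω E × EIT.Diamond M) →L[ℂ] EIT.Diamond M,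
          HasFDerivAt (𝕜 := ℂ)
            (fun q : EIT.LinfDom Ω × EIT.LinfE Ω E × EIT.Diamond M =>
              EIT.potentialMap E q.1 q.2.1 q.2.2) U' (σ, ζ, I) ∧
          (∃ C δ : ℝ, 0 < C ∧ 0 < δ ∧
            ∀ (ω : EIT.LinfDom Ω) (η : EIT.LinfE Ω E) (J : EIT.Diamond M),
              ‖ω‖ ≤ δ → ‖η‖ ≤ δ →
                (σ + ω, ζ + η) ∈ EIT.coercivePairs Ω E ∧
                ‖EIT.potentialMap E (σ + ω) (ζ + η) (I + J) - EIT.potentialMap E σ ζ I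
                    - U' (ω, η, J)‖
                  ≤ C * max (‖ω‖ ^ 2) (max (‖η‖ ^ 2) (‖J‖ ^ 2))) ∧
          ∀ x : EIT.PreH Ω M, EIT.SolvesForward E σ ζ I (EIT.QuotH.mk x) →
            ∀ (ω : EIT.LinfDom Ω) (η : EIT.LinfE Ω E) (J : EIT.Diamond M),
              (∃! p : EIT.QuotH Ω M, EIT.SolvesAux E σ ζ x ω η J p) ∧
              (∀ p : EIT.QuotH Ω M, EIT.SolvesAux E σ ζ x ω η J p →
                U' (ω, η, J) = EIT.electrodePart Ω M p) ∧
              ∀ (I₁ : EIT.Diamond M) (x₁ : EIT.PreH Ω M),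
                EIT.SolvesForward E σ ζ I₁ (EIT.QuotH.mk x₁) →
                  ∑ m, (U' (ω, η, J)).1 m * I₁.1 m
                    = (∑ m, J.1 m * x₁.snd m) - EIT.bilin E ω η x x₁ := by
  obtain ⟨K, _, _, _, ⟨H⟩⟩ := EIT.exists_hilbertModel hΩ hE (by omega)
  refine ⟨H.isOpen_coercivePairs, fun q hq => ⟨hq.1, hq.2 q.1 hq.1⟩, ?_⟩
  rintro σ ζ ⟨hσ, hco⟩
  obtain ⟨c, hc, h⟩ := (H.isCoerciveAt_iff σ ζ).1 hco
  refine ⟨fun I => ⟨H.existsUnique_solvesVar hc h (H.load_eq I), fun p hp => ?_⟩, fun I => ?_⟩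
  · obtain ⟨x, rfl⟩ := Submodule.Quotient.mk_surjective _ p
    rw [H.potentialMap_eq hc h ((H.solvesForward_mk_iff x).1 hp)]
    exact (H.electrodePart_eq x).symm
  obtain ⟨U', ⟨C, δ, hC, hδ, hrem⟩, hU'⟩ := H.exists_quadratic_remainder hσ hc h I
  refine ⟨U', EIT.hasFDerivAt_of_quadratic_remainder hδ fun y hy =>
    (hrem y.1 y.2.1 y.2.2 ((norm_fst_le y).trans hy)
      ((norm_fst_le y.2).trans ((norm_snd_le y).trans hy))).2,
    ⟨C, δ, hC, hδ, fun ω η J hω hη => ⟨(hrem ω η J hω hη).1, (hrem ω η J hω hη).2.trans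
      (mul_le_mul_of_nonneg_left EIT.max_sq_le hC.le)⟩⟩, fun x hx ω η J => ?_⟩
  have hex : ∃! p : EIT.QuotH Ω M, EIT.SolvesAux E σ ζ x ω η J p :=
    H.existsUnique_solvesVar hc h (H.aux_rhs_eq x ω η J)
  have hpart : ∀ p : EIT.QuotH Ω M, EIT.SolvesAux E σ ζ x ω η J p →
      U' (ω, η, J) = EIT.electrodePart Ω M p := fun p hp => by
    obtain ⟨x', rfl⟩ := Submodule.Quotient.mk_surjective _ p
    exact (hU' _ ((H.solvesForward_mk_iff x).1 hx) ω η J _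
      ((H.solvesAux_mk_iff x ω η J x').1 hp)).trans (H.electrodePart_eq x').symm
  refine ⟨hex, hpart, fun I₁ x₁ hx₁ => ?_⟩
  obtain ⟨p, hp⟩ := hex.exists
  obtain ⟨x', rfl⟩ := Submodule.Quotient.mk_surjective _ p
  -- The forward equation for `x₁` is tested with the conjugate of `x'`, and the auxiliary equation
  -- for `x'` with that of `x₁`. By symmetry of `bilin` the left-hand sides agree.
  have e1 := hx₁ x₁ rfl (EIT.conjPre x')
  have e2 := hp x' rfl (EIT.conjPre x₁)
  simp only [EIT.conjPre_snd_apply, Complex.conj_conj, ← EIT.bilin_eq_sesq_conjPre hΩ] at e1 e2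
  rw [hpart _ hp, ← e2, EIT.bilin_comm, e1]
  -- Since `I₁` has zero sum, removing the mean from the potential does not change the pairing.
  have hI : ∑ m, I₁.1 m = 0 := I₁.2
  calc _ = ∑ m, (x'.snd m - (∑ l, x'.snd l) / M) * I₁.1 m := rfl
    _ = (∑ m, I₁.1 m * x'.snd m) - (∑ l, x'.snd l) / M * ∑ m, I₁.1 m := by
      rw [Finset.mul_sum, ← Finset.sum_sub_distrib]
      exact Finset.sum_congr rfl fun m _ => by ring
    _ = _ := by rw [hI, mul_zero, sub_zero]
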